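/- Let $n\ge 3$, $m=2^{n-1}$, and let $\Gamma$ be the 2-gyrogroup of order $2m=2^n$: its elements are $0,1,\dots,2m-1$; put $T_1=\{0,\dots,m-1\}$, $T_2=\{m,\dots,2m-1\}$ and $$i\oplus j=\begin{cases}(i+j)\bmod m, & i,j\in T_1,\\ ((i+j)\bmod m)+m, & i\in T_1,\ j\in T_2,\\ ((i+(\tfrac m2-1)j)\bmod m)+m, & i\in T_2,\ j\in T_1,\\ ((\tfrac m2+1)i+(\tfrac m2-1)j)\bmod m, & i,j\in T_2.\end{cases}$$ Let $1\le k<m$, $r=\frac m2+m$ and $S=\{1,\dots,k\}\cup\{m-k,\dots,m-1\}\cup\{r\}$. Let $C_m^k$ be the $k$-th power of the $m$-cycle: its vertices are the residues modulo $m$, and distinct residues are adjacent iff they differ by $\pm i$ for some $1\le i\le k$. For a finite graph $G$ with maximum degree $\Delta(G)$, let $\chi''(G)$ be the least number of colours in a colouring of the vertices and edges of $G$ in which any two adjacent or incident elements get different colours. $G$ satisfies TCC (the Total Coloring Conjecture) if $\chi''(G)\le\Delta(G)+2$, and $G$ is of type I if $\chi''(G)=\Delta(G)+1$. **Theorem.**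 1. Let $L=C(\Gamma,S)$ be the left Cayley graph (edges $\{x,s\oplus x\}$, $s\in S$). The subgraphs of $L$ induced on $T_1$ and on $T_2$ are both isomorphic to $C_m^k$, and the edges between $T_1$ and $T_2$ form a perfect matching. $L$ satisfies TCC. If $C_m^k$ is of type I, so is $L$. 2. Let $R$ be the underlying undirected graph of the right Cayley graph (edges $\{x,x\oplus s\}$, $s\in S$). The subgraphs of $R$ induced on $T_1$ and on $T_2$ are both isomorphic to $C_m^k$. $R$ satisfies TCC. If $C_m^k$ is of type I, so is $R$. 3. Let $R_0$ be the spanning subgraph of $R$ whose edges are the $\{x,x\oplus s\}$ with $x\in\Gamma$, $s\in S\setminus\{r\}$, and the $\{x,x\oplus r\}$ with $x\in T_1$. Its subgraphs induced on $T_1$ and on $T_2$ are both isomorphic to $C_m^k$, and its edges between $T_1$ and $T_2$ form a perfect matching. $R_0$ satisfies TCC. If $C_m^k$ is of type I, so is $R_0$. -/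

import Mathlib

/-! ### Total colourings -/

/-- `c` colours the vertices and the edges of `G` so that any two distinct elements that are
adjacent or incident receive different colours. -/
def IsTotalColoring {V α : Type*} (G : SimpleGraph V) (c : V ⊕ G.edgeSet → α) : Prop :=
  (∀ u v : V, G.Adj u v → c (Sum.inl u) ≠ c (Sum.inl v)) ∧
  (∀ e f : G.edgeSet, e ≠ f → (∃ v : V, v ∈ e.1 ∧ v ∈ f.1) → c (Sum.inr e) ≠ c (Sum.inr f)) ∧
  (∀ (v : V) (e : G.edgeSet), v ∈ e.1 → c (Sum.inl v) ≠ c (Sum.inr e))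

/-- `G` has a total colouring with `q` colours. -/
def TotalColorable {V : Type*} (G : SimpleGraph V) (q : ℕ) : Prop :=
  ∃ c : V ⊕ G.edgeSet → Fin q, IsTotalColoring G c

/-- The total chromatic number `χ''(G)`. -/
noncomputable def totalChromaticNumber {V : Type*} (G : SimpleGraph V) : ℕ∞ :=
  ⨅ q ∈ {q : ℕ | TotalColorable G q}, (q : ℕ∞)

open Classical in
/-- `Δ(G)`. -/
noncomputable def maxDeg {V : Type*} [Fintype V] (G : SimpleGraph V) : ℕ := G.maxDegree

/-- `G` satisfies the Total Coloring Conjecture: `χ''(G) ≤ Δ(G) + 2`. -/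
def SatisfiesTCC {V : Type*} [Fintype V] (G : SimpleGraph V) : Prop :=
  totalChromaticNumber G ≤ ((maxDeg G + 2 : ℕ) : ℕ∞)

/-- `G` is of type I: `χ''(G) = Δ(G) + 1`. -/
def IsTypeI {V : Type*} [Fintype V] (G : SimpleGraph V) : Prop :=
  totalChromaticNumber G = ((maxDeg G + 1 : ℕ) : ℕ∞)

/-- `G` consists of two copies of `H`, induced on the complementary vertex sets `A` and `B`, and the
edges between `A` and `B` form a perfect matching. -/
def IsTwoCopiesJoinedByMatching {V W : Type*} (G : SimpleGraph V) (H : SimpleGraph W)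
    (A B : Set V) : Prop :=
  IsCompl A B ∧ Nonempty (G.induce A ≃g H) ∧ Nonempty (G.induce B ≃g H) ∧
  (∀ a ∈ A, ∃! b, b ∈ B ∧ G.Adj a b) ∧ (∀ b ∈ B, ∃! a, a ∈ A ∧ G.Adj a b)

/-! ### Powers of cycles -/

/-- The power of a cycle `C_m^k`: the vertices are the residues modulo `m`, and two distinct
residues are adjacent iff they differ by `±i` for some `1 ≤ i ≤ k`. -/
def cyclePower (m k : ℕ) : SimpleGraph (ZMod m) :=
  SimpleGraph.circulantGraph ((fun i : ℕ => (i : ZMod m)) '' Set.Icc 1 k)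

/-! ### Gyrogroups and their Cayley graphs -/

structure Gyrogroup (G : Type*) where
  add : G → G → G
  zero : G
  neg : G → G
  gyr : G → G → G → G
  zero_add : ∀ a, add zero a = a
  neg_add : ∀ a, add (neg a) a = zero
  gyr_bijective : ∀ a b, Function.Bijective (gyr a b)
  gyr_add : ∀ a b c d, gyr a b (add c d) = add (gyr a b c) (gyr a b d)
  gyroassoc : ∀ a b c, add a (add b c) = add (add a b) (gyr a b c)
  left_loop : ∀ a b, gyr a b = gyr (add a b) b

/-- The left Cayley graph: `x` and `s ⊕ x` are joined by an edge, for `s ∈ S`. -/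
def Gyrogroup.leftCayleyGraph {G : Type*} (Γ : Gyrogroup G) (S : Set G) : SimpleGraph G :=
  SimpleGraph.fromRel (fun x y => ∃ s ∈ S, y = Γ.add s x)

/-- The (underlying undirected graph of the) right Cayley graph: `x` and `x ⊕ s` are joined by an
edge, for `s ∈ S`. -/
def Gyrogroup.rightCayleyGraph {G : Type*} (Γ : Gyrogroup G) (S : Set G) : SimpleGraph G :=
  SimpleGraph.fromRel (fun x y => ∃ s ∈ S, y = Γ.add x s)

/-! ### The 2-gyrogroup of order `2 ^ n` -/

namespace TwoGyrogroup

/-- Half of the order, `m = 2 ^ (n - 1)`. -/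
abbrev half (n : ℕ) : ℕ := 2 ^ (n - 1)

/-- `T₁ = {0, …, m - 1}`. -/
def T₁ (n : ℕ) : Set (Fin (2 ^ n)) := {x | x.val < half n}

/-- `T₂ = {m, …, 2 m - 1}`. -/
def T₂ (n : ℕ) : Set (Fin (2 ^ n)) := {x | half n ≤ x.val}

/-- The operation `⊕` on natural numbers, with `m` half of the order. -/
def addNat (m i j : ℕ) : ℕ :=
  if i < m then
    if j < m then (i + j) % m else (i + j) % m + m
  else
    if j < m then (i + (m / 2 - 1) * j) % m + m else ((m / 2 + 1) * i + (m / 2 - 1) * j) % m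

/-- The left inverse. -/
def negNat (m i : ℕ) : ℕ := if i < m then (m - i) % m else i

/-- The gyration `gyr[i, j]`: it fixes `T₁` pointwise, and on `T₂` it is either the identity or
`l ↦ (l + m / 2 mod m) + m`. -/
def gyrNat (m i j l : ℕ) : ℕ :=
  if l < m then l
  else (l + m / 2 * ((if j < m then 0 else i) + (if i < m then 0 else j))) % m + m

theorem two_pow_eq {n : ℕ} (hn : 3 ≤ n) : 2 ^ n = half n + half n := by
  obtain ⟨e, rfl⟩ : ∃ e, n = e + 1 := ⟨n - 1, by omega⟩
  simp only [half, Nat.add_sub_cancel]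
  ring

theorem half_pos (n : ℕ) : 0 < half n := by positivity

theorem addNat_lt {n : ℕ} (hn : 3 ≤ n) (i j : ℕ) : addNat (half n) i j < 2 ^ n := by
  have h := two_pow_eq hn
  have hm := fun a : ℕ => Nat.mod_lt a (half_pos n)
  unfold addNat
  split_ifs
  · have := hm (i + j); omega
  · have := hm (i + j); omega
  · have := hm (i + (half n / 2 - 1) * j); omega
  · have := hm ((half n / 2 + 1) * i + (half n / 2 - 1) * j); omega

theorem negNat_lt {n : ℕ} (hn : 3 ≤ n) (i : Fin (2 ^ n)) : negNat (half n) i < 2 ^ n := by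
  have h := two_pow_eq hn
  have hm := Nat.mod_lt (half n - i) (half_pos n)
  unfold negNat
  split_ifs <;> omega

theorem gyrNat_lt {n : ℕ} (hn : 3 ≤ n) (i j : ℕ) (l : Fin (2 ^ n)) :
    gyrNat (half n) i j l < 2 ^ n := by
  have h := two_pow_eq hn
  have hm := Nat.mod_lt (l + half n / 2 *
    ((if j < half n then 0 else i) + (if i < half n then 0 else j))) (half_pos n)
  unfold gyrNat
  split_ifs at hm ⊢ <;> omega

/-- The residue modulo `m` and the half in which an element lies; these determine the element. -/
def code (m i : ℕ) : ZMod m × Bool := ((i : ZMod m), decide (m ≤ i))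

theorem code_inj {m i j : ℕ} (hi : i < m + m) (hj : j < m + m) (h : code m i = code m j) :
    i = j := by
  obtain ⟨h1, h2⟩ := Prod.ext_iff.1 h
  simp only [code, ZMod.natCast_eq_natCast_iff, Nat.ModEq, decide_eq_decide] at h1 h2
  by_cases hm : m ≤ i
  · have hm' : m ≤ j := h2.1 hm
    rw [Nat.mod_eq_sub_mod hm, Nat.mod_eq_sub_mod hm',
      Nat.mod_eq_of_lt (by omega), Nat.mod_eq_of_lt (by omega)] at h1
    omega
  · have hm' : ¬ m ≤ j := fun h => hm (h2.2 h)
    rwa [Nat.mod_eq_of_lt (by omega), Nat.mod_eq_of_lt (by omega)] at h1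

/-- The operation, read through `code`. -/
def addR {R : Type*} [CommRing R] (h : R) : R × Bool → R × Bool → R × Bool
  | (a, false), (b, false) => (a + b, false)
  | (a, false), (b, true) => (a + b, true)
  | (a, true), (b, false) => (a + (h - 1) * b, true)
  | (a, true), (b, true) => ((h + 1) * a + (h - 1) * b, false)

/-- The gyration, read through `code`. -/
def gyrR {R : Type*} [CommRing R] (h : R) (x y : R × Bool) : R × Bool → R × Bool
  | (c, false) => (c, false)
  | (c, true) => (c + h * ((if y.2 then x.1 else 0) + (if x.2 then y.1 else 0)), true)

section Ring
variable {R : Type*} [CommRing R] {h : R}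

theorem gyrR_gyrR (h2 : 2 * h = 0) (x y z : R × Bool) :
    gyrR h x y (gyrR h x y z) = z := by
  obtain ⟨a, _ | _⟩ := x <;> obtain ⟨b, _ | _⟩ := y <;> obtain ⟨c, _ | _⟩ := z <;>
    simp only [gyrR, Prod.mk.injEq, and_true, if_true, Bool.false_eq_true, if_false]
  · ring
  · linear_combination a * h2
  · linear_combination b * h2
  · linear_combination (a + b) * h2

theorem gyrR_addR (hh : h * h = 0) (x y z w : R × Bool) :
    gyrR h x y (addR h z w) = addR h (gyrR h x y z) (gyrR h x y w) := by
  obtain ⟨c, _ | _⟩ := z <;> obtain ⟨d, _ | _⟩ := w <;>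
    simp only [gyrR, addR, Prod.mk.injEq, and_true] <;>
    generalize (if y.2 then x.1 else 0) + (if x.2 then y.1 else 0) = g
  · ring
  · ring
  · linear_combination -2 * g * hh

theorem addR_assoc (h2 : 2 * h = 0) (hh : h * h = 0) (x y z : R × Bool) :
    addR h x (addR h y z) = addR h (addR h x y) (gyrR h x y z) := by
  obtain ⟨a, _ | _⟩ := x <;> obtain ⟨b, _ | _⟩ := y <;> obtain ⟨c, _ | _⟩ := z <;>
    simp only [gyrR, addR, Prod.mk.injEq, and_true, if_true, Bool.false_eq_true, if_false]
  · ring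
  · ring
  · ring
  · linear_combination (-a) * hh
  · ring
  · linear_combination (-2 * b) * hh + b * h2
  · linear_combination c * hh - c * h2
  · linear_combination (b + c) * hh - (a + b + c) * h2

theorem gyrR_loop (h2 : 2 * h = 0) (hh : h * h = 0) (x y z : R × Bool) :
    gyrR h x y z = gyrR h (addR h x y) y z := by
  obtain ⟨a, _ | _⟩ := x <;> obtain ⟨b, _ | _⟩ := y <;> obtain ⟨c, _ | _⟩ := z <;>
    simp only [gyrR, addR, Prod.mk.injEq, and_true, if_true, Bool.false_eq_true, if_false]
  · linear_combination (-b) * h2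
  · linear_combination (-a - b) * hh + b * h2

end Ring

section Transfer
variable {n : ℕ}

theorem code_lt {m i : ℕ} (hi : i < m) : code m i = ((i : ZMod m), false) := by
  simp [code, hi]

theorem code_ge {m i : ℕ} (hi : ¬ i < m) : code m i = ((i : ZMod m), true) := by
  simpa [code] using hi

theorem code_mod {m : ℕ} (hm : 0 < m) (a : ℕ) : code m (a % m) = ((a : ZMod m), false) := by
  rw [code_lt (Nat.mod_lt a hm), ZMod.natCast_mod]

theorem code_mod_add {m : ℕ} (a : ℕ) : code m (a % m + m) = ((a : ZMod m), true) := by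
  simp [code]

theorem code_addNat {m : ℕ} (hm : 2 ≤ m) (i j : ℕ) :
    code m (addNat m i j) = addR ((m / 2 : ℕ) : ZMod m) (code m i) (code m j) := by
  have h1 : 1 ≤ m / 2 := by omega
  unfold addNat
  split_ifs with hi hj hj
  · rw [code_mod (by omega), code_lt hi, code_lt hj]; simp [addR]
  · rw [code_mod_add, code_lt hi, code_ge hj]; simp [addR]
  · rw [code_mod_add, code_ge hi, code_lt hj]; simp [addR, Nat.cast_sub h1]
  · rw [code_mod (by omega), code_ge hi, code_ge hj]; simp [addR, Nat.cast_sub h1]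

theorem code_gyrNat {m : ℕ} (i j l : ℕ) :
    code m (gyrNat m i j l) = gyrR ((m / 2 : ℕ) : ZMod m) (code m i) (code m j) (code m l) := by
  unfold gyrNat
  split_ifs with hl hj hi hi
  · rw [code_lt hl]; simp [gyrR]
  · rw [code_mod_add, code_ge hl, code_lt hi, code_lt hj]; simp [gyrR]
  · rw [code_mod_add, code_ge hl, code_ge hi, code_lt hj]; simp [gyrR]
  · rw [code_mod_add, code_ge hl, code_lt hi, code_ge hj]; simp [gyrR]
  · rw [code_mod_add, code_ge hl, code_ge hi, code_ge hj]; simp [gyrR]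

theorem four_le_half (hn : 3 ≤ n) : 4 ≤ half n :=
  (Nat.pow_le_pow_right (n := 2) (by norm_num) (show 2 ≤ n - 1 by omega))

theorem half_eq (hn : 3 ≤ n) : ∃ t, half n = 4 * t := by
  refine ⟨2 ^ (n - 3), ?_⟩
  rw [half, show n - 1 = (n - 3) + 2 by omega, pow_add]; ring

theorem two_mul_cast (hn : 3 ≤ n) :
    2 * ((half n / 2 : ℕ) : ZMod (half n)) = 0 := by
  obtain ⟨t, ht⟩ := half_eq hn
  have : 2 * (half n / 2) = half n := by omega
  rw [← Nat.cast_ofNat, ← Nat.cast_mul, this, ZMod.natCast_self]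

theorem cast_mul_cast (hn : 3 ≤ n) :
    ((half n / 2 : ℕ) : ZMod (half n)) * ((half n / 2 : ℕ) : ZMod (half n)) = 0 := by
  obtain ⟨t, ht⟩ := half_eq hn
  have h : half n / 2 * (half n / 2) = half n * t := by
    rw [show half n / 2 = 2 * t by omega, ht]; ring
  rw [← Nat.cast_mul, h, Nat.cast_mul, ZMod.natCast_self, zero_mul]

end Transfer

end TwoGyrogroup

open TwoGyrogroup in
/-- The 2-gyrogroup on `{0, 1, …, 2 ^ n - 1}`. -/
def twoGyrogroup (n : ℕ) (hn : 3 ≤ n) : Gyrogroup (Fin (2 ^ n)) where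
  add i j := ⟨addNat (half n) i j, addNat_lt hn i j⟩
  zero := ⟨0, by positivity⟩
  neg i := ⟨negNat (half n) i, negNat_lt hn i⟩
  gyr i j l := ⟨gyrNat (half n) i j l, gyrNat_lt hn i j l⟩
  zero_add i := by
    have h := two_pow_eq hn
    have hi := i.2
    ext
    simp only [addNat, half_pos, if_true, Nat.zero_add]
    split_ifs with hm
    · exact Nat.mod_eq_of_lt hm
    · rw [Nat.mod_eq_sub_mod (not_lt.1 hm), Nat.mod_eq_of_lt (by omega)]; omega
  neg_add i := by
    have h4 := four_le_half hn
    have hp := two_pow_eq hn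
    refine Fin.ext (code_inj (m := half n) (by rw [← hp]; exact addNat_lt hn _ _) (by omega) ?_)
    simp only
    rw [code_addNat (by omega), code_lt (i := 0) (by omega), negNat]
    split_ifs with hi
    · rw [code_mod (by omega), code_lt hi]
      simp [addR, Nat.cast_sub hi.le]
    · rw [code_ge hi]
      simp only [addR, Nat.cast_zero, Prod.mk.injEq, and_true]
      linear_combination (i.val : ZMod (half n)) * two_mul_cast hn
  gyr_bijective i j := by
    have hp := two_pow_eq hn
    refine Function.Involutive.bijective fun l => ?_
    refine Fin.ext (code_inj (m := half n) (by rw [← hp]; exact gyrNat_lt hn i j ⟨_, _⟩)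
      (by omega) ?_)
    simp only [code_gyrNat]
    exact gyrR_gyrR (two_mul_cast hn) _ _ _
  gyr_add i j l p := by
    have h4 := four_le_half hn
    have hp := two_pow_eq hn
    refine Fin.ext (code_inj (m := half n) (by rw [← hp]; exact gyrNat_lt hn i j ⟨_, _⟩)
      (by rw [← hp]; exact addNat_lt hn _ _) ?_)
    simp only [code_gyrNat, code_addNat (show 2 ≤ half n by omega)]
    exact gyrR_addR (cast_mul_cast hn) _ _ _ _
  gyroassoc i j l := by
    have h4 := four_le_half hn
    have hp := two_pow_eq hn
    refine Fin.ext (code_inj (m := half n) (by rw [← hp]; exact addNat_lt hn _ _)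
      (by rw [← hp]; exact addNat_lt hn _ _) ?_)
    simp only [code_gyrNat, code_addNat (show 2 ≤ half n by omega)]
    exact addR_assoc (two_mul_cast hn) (cast_mul_cast hn) _ _ _
  left_loop i j := by
    have h4 := four_le_half hn
    have hp := two_pow_eq hn
    funext l
    refine Fin.ext (code_inj (m := half n) (by rw [← hp]; exact gyrNat_lt hn i j l)
      (by rw [← hp]; exact gyrNat_lt hn _ j l) ?_)
    simp only [code_gyrNat, code_addNat (show 2 ≤ half n by omega)]
    exact gyrR_loop (two_mul_cast hn) (cast_mul_cast hn) _ _ _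

namespace TwoGyrogroup

/-- The element `m / 2 + m`. -/
def reflection (n : ℕ) (hn : 3 ≤ n) : Fin (2 ^ n) :=
  ⟨half n / 2 + half n, by have := two_pow_eq hn; have := half_pos n; omega⟩

/-- `S = {1, …, k, m - k, …, m - 1, m / 2 + m}`. -/
def genSet (n k : ℕ) : Set (Fin (2 ^ n)) :=
  {x | (1 ≤ x.val ∧ x.val ≤ k) ∨ (half n - k ≤ x.val ∧ x.val ≤ half n - 1) ∨
    x.val = half n / 2 + half n}

/-- The spanning subgraph of the right Cayley graph in which, of the edges `{x, x ⊕ (m / 2 + m)}`,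
only those with `x ∈ T₁` are kept. -/
def rightMatchingGraph (n : ℕ) (hn : 3 ≤ n) (k : ℕ) : SimpleGraph (Fin (2 ^ n)) :=
  SimpleGraph.fromRel (fun x y => ∃ s ∈ genSet n k,
    y = (twoGyrogroup n hn).add x s ∧ (s = reflection n hn → x ∈ T₁ n))

end TwoGyrogroup

/-! In suitable coordinates (`leftIso`, `rightMatchingIso`, `rightIso`) the graphs `L` and `R₀`
become one and the same model: two copies of `C_m^k` joined by the matching `a ↦ a + (m/2) a`
(`twist`), which fixes even residues and moves odd ones by `m/2`. The graph `R` is this model with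
the identity matching added. If `C_m^k` has degree `D`, the model has a vertex of degree `D + 1`, so
TCC follows from `D + 3` colours and type I from `D + 2`. If the two copies of every residue are
also coloured differently, the identity matching of `R` can be given one new colour; an odd residue
has degree `D + 2` there, so the bounds carry over.

It remains to colour the model (`exists_modelColorable`). For `k ≥ m/2` the cycle power is the
complete graph `K_m`, and a total colouring of it is used on both copies, shifted by `1` on the
second, with one extra colour for the matching. For `k = 1` (below `m/2`) five colours suffice by
parity, and the type I claim is vacuous because `3 ∤ m` (`not_totalColorable_cycle`).

For `2 ≤ k < m/2` the model gets `2k + 2 = D + 2` colours unconditionally (`modelColorable_of_lt`).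
Let `p` be the largest power of two with `p ≤ k`. The differences below `p`, half of the edges of
difference `p`, and the cross matching form a graph that reduction modulo `2p` maps, injectively on
neighbourhoods, to the prism over `K_{2p}`. That prism has a total colouring with `2p + 1` colours
(`exists_extendsToTotal_completePrism`), which is pulled back. The other half of difference `p` is
one matching, each further difference up to `k` splits into two, and every matching takes a new
colour: `2p + 1 + 1 + 2(k - p) = 2k + 2`. -/

/-! ### Total colourings: restriction, pullback, added matchings, degree bounds -/

section TotalColoring

variable {V W : Type*}

/-- The vertex colouring `cv` extends to a total colouring of `G` with colours `0, …, N - 1`. -/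
def ExtendsToTotal (G : SimpleGraph V) (cv : V → ℕ) (N : ℕ) : Prop :=
  (∀ v, cv v < N) ∧ (∀ u v, G.Adj u v → cv u ≠ cv v) ∧
  ∃ ce : V → V → ℕ, ∀ u v, G.Adj u v → ce u v = ce v u ∧ ce u v < N ∧ cv u ≠ ce u v ∧
    ∀ w, G.Adj u w → v ≠ w → ce u v ≠ ce u w

theorem ExtendsToTotal.totalColorable {G : SimpleGraph V} {cv : V → ℕ} {N : ℕ}
    (h : ExtendsToTotal G cv N) : TotalColorable G N := by
  obtain ⟨hlt, hv, ce, hce⟩ := h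
  -- Each edge gets an arbitrary orientation; the symmetry of `ce` makes the choice irrelevant,
  -- which is what `key` records.
  have hs : ∀ e : G.edgeSet, ∃ u v, G.Adj u v ∧ e.1 = s(u, v) := by
    rintro ⟨e, he⟩
    induction e using Sym2.ind with
    | _ u v => exact ⟨u, v, he, rfl⟩
  choose a b hab he using hs
  have key : ∀ (e : G.edgeSet) (v : V), v ∈ e.1 →
      ∃ w, G.Adj v w ∧ e.1 = s(v, w) ∧ ce (a e) (b e) = ce v w := by
    intro e v hve
    rw [he e, Sym2.mem_iff] at hve
    rcases hve with rfl | rfl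
    · exact ⟨b e, hab e, he e, rfl⟩
    · exact ⟨a e, (hab e).symm, (he e).trans Sym2.eq_swap, (hce _ _ (hab e)).1⟩
  refine ⟨Sum.elim (fun v => ⟨cv v, hlt v⟩)
    (fun e => ⟨ce (a e) (b e), (hce _ _ (hab e)).2.1⟩), ?_, ?_, ?_⟩
  · intro u v huv
    simpa using hv u v huv
  · rintro e f hef ⟨v, hve, hvf⟩
    obtain ⟨w, hw, hew, h1⟩ := key e v hve
    obtain ⟨x, hx, hfx, h2⟩ := key f v hvf
    have hwx : w ≠ x := by
      rintro rfl
      exact hef (Subtype.ext (hew.trans hfx.symm))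
    simpa [h1, h2] using (hce v w hw).2.2.2 x hx hwx
  · intro v e hve
    obtain ⟨w, hw, -, h1⟩ := key e v hve
    simpa [h1] using (hce v w hw).2.2.1

theorem TotalColorable.exists_extendsToTotal {G : SimpleGraph V} {N : ℕ}
    (h : TotalColorable G N) : ∃ cv, ExtendsToTotal G cv N := by
  classical
  obtain ⟨c, h1, h2, h3⟩ := h
  refine ⟨fun v => c (Sum.inl v), fun v => (c _).2, fun u v huv => ?_,
    -- The value `0` on non-adjacent pairs is never read.
    fun u v => if huv : G.Adj u v then c (Sum.inr ⟨s(u, v), huv⟩) else 0, fun u v huv => ?_⟩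
  · simpa [Fin.ext_iff] using h1 u v huv
  · simp only [huv, huv.symm, dif_pos]
    refine ⟨?_, (c _).2, ?_, ?_⟩
    · congr 4
      exact Sym2.eq_swap
    · simpa [Fin.ext_iff] using h3 u ⟨s(u, v), huv⟩ (Sym2.mem_mk_left _ _)
    · intro w huw hvw
      simp only [huw, dif_pos]
      have := h2 ⟨s(u, v), huv⟩ ⟨s(u, w), huw⟩ (fun h => hvw (Sym2.congr_right.1 (Subtype.ext_iff.1 h)))
        ⟨u, Sym2.mem_mk_left _ _, Sym2.mem_mk_left _ _⟩
      simpa [Fin.ext_iff] using this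

theorem ExtendsToTotal.mono {G G' : SimpleGraph V} {cv : V → ℕ} {N : ℕ} (hle : G' ≤ G)
    (h : ExtendsToTotal G cv N) : ExtendsToTotal G' cv N := by
  obtain ⟨hlt, hv, ce, hce⟩ := h
  refine ⟨hlt, fun u v huv => hv u v (hle huv), ce, fun u v huv => ?_⟩
  obtain ⟨a, b, c, d⟩ := hce u v (hle huv)
  exact ⟨a, b, c, fun w hw => d w (hle hw)⟩

/-- Pulling back along a locally injective homomorphism. -/
theorem ExtendsToTotal.comap {G : SimpleGraph V} {G' : SimpleGraph W} {cv : W → ℕ} {N : ℕ}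
    (h : ExtendsToTotal G' cv N) (p : V → W) (hp : ∀ u v, G.Adj u v → G'.Adj (p u) (p v))
    (hinj : ∀ u v w, G.Adj u v → G.Adj u w → p v = p w → v = w) :
    ExtendsToTotal G (cv ∘ p) N := by
  obtain ⟨hlt, hv, ce, hce⟩ := h
  refine ⟨fun v => hlt _, fun u v huv => hv _ _ (hp u v huv), fun u v => ce (p u) (p v),
    fun u v huv => ?_⟩
  obtain ⟨a, b, c, d⟩ := hce _ _ (hp u v huv)
  exact ⟨a, b, c, fun w hw hvw => d _ (hp u w hw) fun h => hvw (hinj u v w huv hw h)⟩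

/-- A matching can be added at the cost of one colour. -/
theorem ExtendsToTotal.sup_matching {G M : SimpleGraph V} {cv : V → ℕ} {N : ℕ}
    (h : ExtendsToTotal G cv N) (hM : ∀ u v w, M.Adj u v → M.Adj u w → v = w)
    (hcv : ∀ u v, M.Adj u v → cv u ≠ cv v) : ExtendsToTotal (G ⊔ M) cv (N + 1) := by
  classical
  obtain ⟨hlt, hv, ce, hce⟩ := h
  refine ⟨fun v => (hlt v).trans N.lt_succ_self, ?_,
    fun u v => if M.Adj u v then N else ce u v, ?_⟩
  · rintro u v (huv | huv)
    exacts [hv u v huv, hcv u v huv]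
  · intro u v huv
    have hG : ∀ {x}, (G ⊔ M).Adj u x → ¬ M.Adj u x → G.Adj u x := fun h h' => h.resolve_right h'
    by_cases hm : M.Adj u v
    · simp only [hm, hm.symm, if_true]
      refine ⟨trivial, N.lt_succ_self, (hlt u).ne, fun w hw hvw => ?_⟩
      have hmw : ¬ M.Adj u w := fun hmw => hvw (hM u v w hm hmw)
      simp only [hmw, if_false]
      exact (hce u w (hG hw hmw)).2.1.ne'
    · have hm' : ¬ M.Adj v u := fun h => hm h.symm
      obtain ⟨a, b, c, d⟩ := hce u v (hG huv hm)
      simp only [hm, hm', if_false]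
      refine ⟨a, b.trans N.lt_succ_self, c, fun w hw hvw => ?_⟩
      by_cases hmw : M.Adj u w
      · simpa [hmw] using b.ne
      · simpa [hmw] using d w (hG hw hmw) hvw

theorem TotalColorable.of_iso {G : SimpleGraph V} {G' : SimpleGraph W} (e : G ≃g G') {N : ℕ}
    (h : TotalColorable G' N) : TotalColorable G N := by
  obtain ⟨cv, h⟩ := h.exists_extendsToTotal
  exact (h.comap e (fun u v huv => e.map_adj_iff.2 huv)
    fun u v w _ _ h => e.injective h).totalColorable

theorem le_maxDeg [Fintype V] {G : SimpleGraph V} (v : V) (s : Finset V)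
    (hs : ∀ w ∈ s, G.Adj v w) : s.card ≤ maxDeg G := by
  classical
  refine le_trans ?_ (G.degree_le_maxDegree v)
  rw [← SimpleGraph.card_neighborFinset_eq_degree]
  exact Finset.card_le_card fun w hw => by simpa using hs w hw

theorem le_maxDeg_of_iso [Fintype V] [Fintype W] {G : SimpleGraph V} {G' : SimpleGraph W}
    (e : G ≃g G') (v : W) (s : Finset W) (hs : ∀ w ∈ s, G'.Adj v w) : s.card ≤ maxDeg G := by
  classical
  rw [← Finset.card_image_of_injective s e.symm.injective]
  refine le_maxDeg (e.symm v) _ fun w hw => ?_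
  obtain ⟨x, hx, rfl⟩ := Finset.mem_image.1 hw
  exact e.symm.map_adj_iff.2 (hs x hx)

/-- A vertex of maximum degree and its incident edges are pairwise in conflict. -/
theorem maxDeg_add_one_le_of_totalColorable [Fintype V] [Nonempty V] {G : SimpleGraph V} {N : ℕ}
    (h : TotalColorable G N) : maxDeg G + 1 ≤ N := by
  classical
  obtain ⟨cv, hlt, hv, ce, hce⟩ := h.exists_extendsToTotal
  obtain ⟨v, hdeg⟩ := G.exists_maximal_degree_vertex
  have hd : maxDeg G = G.degree v := by
    rw [← hdeg]
    unfold maxDeg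
    congr!
  rw [hd, ← SimpleGraph.card_neighborFinset_eq_degree]
  have h1 : ((G.neighborFinset v).image (ce v)).card = (G.neighborFinset v).card := by
    refine Finset.card_image_of_injOn fun x hx y hy hxy => ?_
    by_contra hne
    exact (hce v x (by simpa using hx)).2.2.2 y (by simpa using hy) hne hxy
  have h2 : cv v ∉ (G.neighborFinset v).image (ce v) := by
    simp only [Finset.mem_image, SimpleGraph.mem_neighborFinset, not_exists, not_and]
    exact fun x hx h => (hce v x hx).2.2.1 h.symm
  rw [← h1, ← Finset.card_insert_of_notMem h2, ← Finset.card_range N]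
  refine Finset.card_le_card fun x hx => ?_
  simp only [Finset.mem_insert, Finset.mem_image, SimpleGraph.mem_neighborFinset] at hx
  rw [Finset.mem_range]
  rcases hx with rfl | ⟨y, hy, rfl⟩
  exacts [hlt v, (hce v y hy).2.1]

theorem TotalColorable.totalChromaticNumber_le {G : SimpleGraph V} {N : ℕ}
    (h : TotalColorable G N) : totalChromaticNumber G ≤ N :=
  iInf₂_le (f := fun (q : ℕ) (_ : q ∈ {q : ℕ | TotalColorable G q}) => (q : ℕ∞)) N h

theorem TotalColorable.satisfiesTCC [Fintype V] {G : SimpleGraph V} {N : ℕ}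
    (h : TotalColorable G N) (hN : N ≤ maxDeg G + 2) : SatisfiesTCC G :=
  h.totalChromaticNumber_le.trans (by exact_mod_cast hN)

theorem TotalColorable.isTypeI [Fintype V] [Nonempty V] {G : SimpleGraph V} {N : ℕ}
    (h : TotalColorable G N) (hN : N ≤ maxDeg G + 1) : IsTypeI G :=
  le_antisymm (h.totalChromaticNumber_le.trans (by exact_mod_cast hN))
    (le_iInf₂ fun q hq => by exact_mod_cast maxDeg_add_one_le_of_totalColorable hq)

theorem TotalColorable.mono {G : SimpleGraph V} {N N' : ℕ} (h : TotalColorable G N)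
    (hN : N ≤ N') : TotalColorable G N' := by
  obtain ⟨c, h1, h2, h3⟩ := h
  have hi := Fin.castLE_injective hN
  exact ⟨fun x => Fin.castLE hN (c x), fun u v huv h => h1 u v huv (hi h),
    fun e f hef hv h => h2 e f hef hv (hi h), fun v e hve h => h3 v e hve (hi h)⟩

/-- The infimum is attained: otherwise, by monotonicity in the number of colours, every admissible
number would be at least `Δ + 2`. -/
theorem IsTypeI.totalColorable [Fintype V] {G : SimpleGraph V} (h : IsTypeI G) :
    TotalColorable G (maxDeg G + 1) := by
  by_contra hn
  have : ((maxDeg G + 1 + 1 : ℕ) : ℕ∞) ≤ totalChromaticNumber G := by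
    refine le_iInf₂ fun q hq => ?_
    by_contra hlt
    have hlt' : q < maxDeg G + 1 + 1 := by exact_mod_cast not_le.1 hlt
    exact hn (TotalColorable.mono hq (by omega))
  rw [h] at this
  have : maxDeg G + 1 + 1 ≤ maxDeg G + 1 := by exact_mod_cast this
  omega

end TotalColoring

/-! ### Doubled graphs and splitting a difference into two matchings -/

section Copies

/-- Two disjoint copies of `H`. -/
def twoCopies {W : Type*} (H : SimpleGraph W) : SimpleGraph (W × Bool) where
  Adj u v := u.2 = v.2 ∧ H.Adj u.1 v.1
  symm := ⟨fun _ _ h => ⟨h.1.symm, h.2.symm⟩⟩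
  loopless := ⟨fun _ h => H.loopless.irrefl _ h.2⟩

/-- The edges `{(a, false), (f a, true)}` and `{(a, true), (f a, false)}`. -/
def crossGraph {W : Type*} (f : W → W) : SimpleGraph (W × Bool) where
  Adj u v := u.2 ≠ v.2 ∧ (v.1 = f u.1 ∨ u.1 = f v.1)
  symm := ⟨fun _ _ h => ⟨h.1.symm, h.2.symm⟩⟩
  loopless := ⟨fun _ h => h.1 rfl⟩

/-- The edges `{a, a + j}` with `β a = true`. -/
def halfShift {m : ℕ} (j : ZMod m) (β : ZMod m → Bool) : SimpleGraph (ZMod m) :=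
  SimpleGraph.fromRel fun a b => b = a + j ∧ β a = true

theorem crossGraph_matching {W : Type*} {f : W → W} (hf : Function.Involutive f)
    (u v w : W × Bool) (hv : (crossGraph f).Adj u v) (hw : (crossGraph f).Adj u w) : v = w := by
  obtain ⟨a, ε⟩ := u
  obtain ⟨b, δ⟩ := v
  obtain ⟨c, γ⟩ := w
  obtain ⟨h1, h2⟩ := hv
  obtain ⟨h3, h4⟩ := hw
  simp only at h1 h2 h3 h4
  have h5 : b = f a := h2.elim id fun h => by rw [h, hf]
  have h6 : c = f a := h4.elim id fun h => by rw [h, hf]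
  have h7 : δ = γ := by revert h1 h3; cases ε <;> cases δ <;> cases γ <;> simp
  rw [h5, h6, h7]

theorem twoCopies_matching {W : Type*} {H : SimpleGraph W}
    (hH : ∀ u v w, H.Adj u v → H.Adj u w → v = w) (u v w : W × Bool)
    (hv : (twoCopies H).Adj u v) (hw : (twoCopies H).Adj u w) : v = w :=
  Prod.ext (hH _ _ _ hv.2 hw.2) (hv.1.symm.trans hw.1)

theorem halfShift_adj {m : ℕ} {j : ZMod m} {β : ZMod m → Bool} {a b : ZMod m}
    (h : (halfShift j β).Adj a b) : (b = a + j ∧ β a = true) ∨ (a = b + j ∧ β b = true) := by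
  simpa [halfShift, SimpleGraph.fromRel_adj] using h.2

/-- Of the two candidate edges at `a`, to `a + j` and to `a - j`, the alternation of `β` keeps only
one. -/
theorem halfShift_matching {m : ℕ} {j : ZMod m} {β : ZMod m → Bool}
    (hβ : ∀ a, β (a + j) = !β a) (a b c : ZMod m) (hb : (halfShift j β).Adj a b)
    (hc : (halfShift j β).Adj a c) : b = c := by
  have h1 := hβ b
  have h2 := hβ c
  rcases halfShift_adj hb with ⟨rfl, h⟩ | ⟨rfl, h⟩ <;>
    rcases halfShift_adj hc with ⟨h3, h4⟩ | ⟨h3, h4⟩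
  · exact h3.symm
  · rw [← h3, h, h4] at h2; simp at h2
  · rw [h4, h] at h1; simp at h1
  · exact add_right_cancel h3

theorem cyclePower_adj {m k : ℕ} {a b : ZMod m} :
    (cyclePower m k).Adj a b ↔
      a ≠ b ∧ ∃ i : ℕ, 1 ≤ i ∧ i ≤ k ∧ (b = a + i ∨ a = b + i) := by
  simp only [cyclePower, SimpleGraph.circulantGraph, SimpleGraph.fromRel_adj, Set.mem_image,
    Set.mem_Icc]
  refine and_congr_right fun _ => ⟨?_, ?_⟩
  · rintro (⟨i, ⟨h1, h2⟩, h3⟩ | ⟨i, ⟨h1, h2⟩, h3⟩)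
    · exact ⟨i, h1, h2, Or.inr (by rw [h3]; ring)⟩
    · exact ⟨i, h1, h2, Or.inl (by rw [h3]; ring)⟩
  · rintro ⟨i, h1, h2, h3 | h3⟩
    · exact Or.inr ⟨i, ⟨h1, h2⟩, by rw [h3]; ring⟩
    · exact Or.inl ⟨i, ⟨h1, h2⟩, by rw [h3]; ring⟩

theorem natCast_ne_zero_of_lt {m i : ℕ} (h0 : 0 < i) (hi : i < m) : (i : ZMod m) ≠ 0 := by
  rw [Ne, ZMod.natCast_eq_zero_iff]
  exact Nat.not_dvd_of_pos_of_lt h0 hi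

/-- An inclusion is enough, since total colourings restrict to subgraphs. The two half shifts become
matchings only once `β` alternates. -/
theorem cyclePower_succ_le {m k : ℕ} (β : ZMod m → Bool) :
    cyclePower m (k + 1) ≤ cyclePower m k ⊔ halfShift ((k + 1 : ℕ) : ZMod m) β ⊔
      halfShift ((k + 1 : ℕ) : ZMod m) (fun a => !β a) := by
  intro a b hab
  obtain ⟨hne, i, h1, h2, h3⟩ := cyclePower_adj.1 hab
  rcases Nat.lt_or_ge k i with hki | hki
  · obtain rfl : i = k + 1 := by omega
    simp only [SimpleGraph.sup_adj, halfShift, SimpleGraph.fromRel_adj]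
    have hβ : ∀ x, β x = true ∨ (!β x) = true := fun x => by cases β x <;> simp
    have ha := hβ a
    have hb := hβ b
    tauto
  · exact Or.inl (Or.inl (cyclePower_adj.2 ⟨hne, i, h1, hki, h3⟩))

theorem twoCopies_sup {W : Type*} (H H' : SimpleGraph W) :
    twoCopies (H ⊔ H') = twoCopies H ⊔ twoCopies H' := by
  ext u v
  simp [twoCopies, and_or_left]

theorem twoCopies_mono {W : Type*} {H H' : SimpleGraph W} (h : H ≤ H') :
    twoCopies H ≤ twoCopies H' := fun _ _ huv => ⟨huv.1, h huv.2⟩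

/-- A residue shift by `j` splits the residues modulo `2 ^ t` into two alternating classes. -/
theorem exists_alternating {t j : ℕ} (h0 : 0 < j) (hj : j < 2 ^ t) :
    ∃ β : ZMod (2 ^ t) → Bool, ∀ a, β (a + j) = !β a := by
  obtain ⟨s, o, ho, rfl⟩ := Nat.exists_eq_two_pow_mul_odd h0.ne'
  have hs : s < t := by
    by_contra hst
    have h1 := Nat.pow_le_pow_right (n := 2) (by norm_num) (not_lt.1 hst)
    have h2 := Nat.le_mul_of_pos_right (2 ^ s) ho.pos
    omega
  -- With `j = 2 ^ s * o` and `o` odd, adding `j` leaves the bits below `s` alone and flips bit `s`;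
  -- as `s < t`, reduction modulo `2 ^ t` does not touch that bit.
  refine ⟨fun a => a.val.testBit s, fun a => ?_⟩
  have hp : 0 < 2 ^ s := by positivity
  beta_reduce
  rw [ZMod.val_add, ZMod.val_natCast, Nat.add_mod_mod, Nat.testBit_mod_two_pow]
  simp only [hs, decide_true, Bool.true_and, Nat.testBit_eq_decide_div_mod_eq,
    Nat.add_mul_div_left _ _ hp]
  obtain ⟨r, rfl⟩ := ho
  rcases Nat.mod_two_eq_zero_or_one (a.val / 2 ^ s) with h | h <;> simp [h] <;> omega

/-- Raising the power of the cycle by one costs two colours. -/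
theorem ExtendsToTotal.cyclePower_succ {t k : ℕ} {X : SimpleGraph (ZMod (2 ^ t) × Bool)}
    {cv : ZMod (2 ^ t) × Bool → ℕ} {N : ℕ}
    (h : ExtendsToTotal (twoCopies (cyclePower (2 ^ t) k) ⊔ X) cv N) (hk : k + 1 < 2 ^ t)
    (hcv : ∀ a ε, cv (a, ε) ≠ cv (a + ((k + 1 : ℕ) : ZMod (2 ^ t)), ε)) :
    ExtendsToTotal (twoCopies (cyclePower (2 ^ t) (k + 1)) ⊔ X) cv (N + 2) := by
  obtain ⟨β, hβ⟩ := exists_alternating k.succ_pos hk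
  have hc : ∀ (γ : ZMod (2 ^ t) → Bool) u v,
      (twoCopies (halfShift ((k + 1 : ℕ) : ZMod (2 ^ t)) γ)).Adj u v → cv u ≠ cv v := by
    rintro γ ⟨a, ε⟩ ⟨b, δ⟩ ⟨h1, h2⟩
    simp only at h1 h2
    subst h1
    rcases halfShift_adj h2 with ⟨rfl, -⟩ | ⟨rfl, -⟩
    exacts [hcv _ _, (hcv _ _).symm]
  refine ((h.sup_matching (twoCopies_matching (halfShift_matching hβ)) (hc _)).sup_matching
    (twoCopies_matching (halfShift_matching (β := fun a => !β a) ?_)) (hc _)).mono ?_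
  · exact fun a => congrArg not (hβ a)
  · refine sup_le ?_ ?_
    · refine (twoCopies_mono (cyclePower_succ_le β)).trans ?_
      rw [twoCopies_sup, twoCopies_sup]
      exact sup_le (sup_le (le_sup_left.trans (le_sup_left.trans le_sup_left))
        (le_sup_right.trans le_sup_left)) le_sup_right
    · exact (le_sup_right.trans le_sup_left).trans le_sup_left

end Copies

/-! ### Total colouring of the prism over a complete graph of even order -/

section CompletePrism

/-- The prism over the complete graph on the nonzero residues modulo `N`. -/
def completePrism (N : ℕ) : SimpleGraph (ZMod N × Bool) where
  Adj u v := u.1 ≠ 0 ∧ v.1 ≠ 0 ∧ ((u.2 = v.2 ∧ u.1 ≠ v.1) ∨ (u.2 ≠ v.2 ∧ u.1 = v.1))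
  symm := ⟨fun _ _ h => ⟨h.2.1, h.1, h.2.2.imp (fun h => ⟨h.1.symm, h.2.symm⟩)
    fun h => ⟨h.1.symm, h.2.symm⟩⟩⟩
  loopless := ⟨fun _ h => by simp at h⟩

theorem two_mul_injective {N : ℕ} (hN : Odd N) :
    Function.Injective (fun x : ZMod N => 2 * x) := by
  have h : IsUnit (2 : ZMod N) := by
    exact_mod_cast (ZMod.isUnit_iff_coprime 2 N).2 (Nat.coprime_two_left.2 hN)
  exact h.mul_right_injective

/-- Such an `f` relabels the second copy of the complete graph so that the two ends of each rung get
different colours. -/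
theorem exists_not_commute_two_mul {N : ℕ} (hN : Odd N) (h5 : 5 ≤ N) :
    ∃ f : ZMod N → ZMod N, Function.Injective f ∧ f 0 = 0 ∧
      ∀ x, x ≠ 0 → f (2 * x) ≠ 2 * f x := by
  rcases eq_or_ne N 5 with rfl | hne
  · exact ⟨Equiv.swap 2 3, (Equiv.swap _ _).injective, by decide, by decide⟩
  have h7 : 7 ≤ N := by obtain ⟨r, rfl⟩ := hN; omega
  have hc : ∀ i : ℕ, 0 < i → i < 7 → (i : ZMod N) ≠ 0 := fun i h0 hi =>
    natCast_ne_zero_of_lt h0 (hi.trans_le h7)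
  have c1 : (1 : ZMod N) ≠ 0 := by exact_mod_cast hc 1 (by norm_num) (by norm_num)
  have c2 : (2 : ZMod N) ≠ 0 := by exact_mod_cast hc 2 (by norm_num) (by norm_num)
  have c3 : (3 : ZMod N) ≠ 0 := by exact_mod_cast hc 3 (by norm_num) (by norm_num)
  have c5 : (5 : ZMod N) ≠ 0 := by exact_mod_cast hc 5 (by norm_num) (by norm_num)
  have h2 := two_mul_injective hN
  -- This is the cycle `2 → 3 → ⋯ → -1 → 2`. Generically `f (2x) = 2x + 1` while `2 f x = 2x + 2`.
  -- At `x = -1` the values are `-1` and `4`, which agree modulo `5`; hence the separate case above.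
  refine ⟨fun x => if x = 0 ∨ x = 1 then x else if x = -1 then 2 else x + 1, ?_, by simp, ?_⟩
  · intro x y hxy
    simp only at hxy
    split_ifs at hxy <;> grind
  · intro x hx
    have h20 : 2 * x ≠ 0 := fun h => hx (h2 (by simpa using h))
    simp only
    split_ifs <;> first | exact fun h => c1 (by linear_combination -h) | grind

/-- On nonzero residues, colour the vertex `x` by `2x` and the edge `xy` by `x + y`. The only colour
missing at `x` is `x + 0 = x`. Conjugating by a permutation fixing `0` keeps the missing colour
equal to `x`, so the rung at `x` can take it in both copies. The ends of the rung differ because the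
permutation does not commute with doubling. -/
theorem exists_extendsToTotal_completePrism {N : ℕ} (hN : Odd N) (h5 : 5 ≤ N) :
    ∃ cv, ExtendsToTotal (completePrism N) cv N := by
  have : NeZero N := ⟨by omega⟩
  obtain ⟨f, hf, hf0, hf2⟩ := exists_not_commute_two_mul hN h5
  have h2 := two_mul_injective hN
  obtain ⟨e, he⟩ : ∃ e : Equiv.Perm (ZMod N), ∀ x, e x = f x :=
    ⟨Equiv.ofBijective f (Finite.injective_iff_bijective.1 hf), fun _ => rfl⟩
  -- One relabelling per copy, the identity and `e`, so that both copies are treated by the same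
  -- formula.
  obtain ⟨E, E0, Ec⟩ : ∃ E : Bool → Equiv.Perm (ZMod N), (∀ ε x, x ≠ 0 → E ε x ≠ 0) ∧
      ∀ ε δ x, ε ≠ δ → x ≠ 0 → (E ε).symm (2 * E ε x) ≠ (E δ).symm (2 * E δ x) := by
    refine ⟨fun ε => if ε then e else Equiv.refl _, ?_, ?_⟩
    · rintro (_ | _) x hx
      · simpa using hx
      · simp only [if_true, he]
        exact fun h => hx (hf (h.trans hf0.symm))
    · have key : ∀ x, x ≠ 0 → e.symm (2 * e x) ≠ 2 * x := by
        intro x hx h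
        rw [Equiv.symm_apply_eq, he, he] at h
        exact hf2 x hx h.symm
      rintro (_ | _) (_ | _) x hne hx
      · exact absurd rfl hne
      · simpa using (key x hx).symm
      · simpa using key x hx
      · exact absurd rfl hne
  refine ⟨fun u => ((E u.2).symm (2 * E u.2 u.1)).val, fun u => ZMod.val_lt _, ?_,
    fun u v => (if u.2 = v.2 then (E u.2).symm (E u.2 u.1 + E u.2 v.1) else u.1).val, ?_⟩
  · rintro ⟨x, ε⟩ ⟨y, δ⟩ ⟨hx, hy, ⟨h1, h3⟩ | ⟨h1, h3⟩⟩ h <;> simp only at hx hy h1 h3 h <;>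
      subst_vars <;> replace h := ZMod.val_injective N h
    · exact h3 ((E _).injective (h2 ((E _).symm.injective h)))
    · exact Ec _ _ _ h1 hx h
  · rintro ⟨x, ε⟩ ⟨y, δ⟩ ⟨hx, hy, ⟨h1, h3⟩ | ⟨h1, h3⟩⟩ <;> simp only at hx hy h1 h3 <;>
      subst_vars
    · simp only [if_true]
      refine ⟨by rw [add_comm], ZMod.val_lt _, fun h => ?_, ?_⟩
      · have h := (E _).symm.injective (ZMod.val_injective N h)
        rw [two_mul] at h
        exact h3 ((E _).injective (add_left_cancel h))
      · rintro ⟨z, γ⟩ ⟨-, hz, ⟨h1, h4⟩ | ⟨h1, h4⟩⟩ hne h <;> simp only at hz h1 h4 h <;>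
          subst_vars
        · simp only [if_true] at h
          have h := (E _).symm.injective (ZMod.val_injective N h)
          exact hne (by rw [(E _).injective (add_left_cancel h)])
        · rw [if_neg h1] at h
          have h := ZMod.val_injective N h
          rw [Equiv.symm_apply_eq] at h
          exact E0 _ y hy (by simpa using h)
    · simp only [h1, h1.symm, if_false]
      refine ⟨trivial, ZMod.val_lt _, fun h => ?_, ?_⟩
      · have h := ZMod.val_injective N h
        rw [Equiv.symm_apply_eq, two_mul] at h
        exact E0 _ _ hx (by simpa using h)
      · rintro ⟨z, γ⟩ ⟨-, hz, ⟨h5, h4⟩ | ⟨h5, h4⟩⟩ hne h <;> simp only at hz h5 h4 h <;>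
          subst_vars
        · simp only [if_true] at h
          have h := ZMod.val_injective N h
          rw [eq_comm, Equiv.symm_apply_eq] at h
          exact E0 _ z hz (by simpa using h)
        · exact hne (by congr 1; revert h1 h5; cases ε <;> cases δ <;> cases γ <;> simp)

end CompletePrism

/-! ### Pulling the prism colouring back along reduction modulo `2p` -/

section Covering

/-- Signed differences make the local injectivity visible: `p` and `-p` are the only two in range
that agree modulo `2p` without being equal, and `β a` permits just one of them at `a`. -/
theorem exists_int_of_adj {m p : ℕ} {β : ZMod m → Bool} (hp : 0 < p)
    (hβ : ∀ a, β (a + (p : ℕ)) = !β a) {a b : ZMod m}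
    (h : (cyclePower m (p - 1) ⊔ halfShift (p : ZMod m) β).Adj a b) :
    ∃ d : ℤ, b = a + d ∧ d ≠ 0 ∧ -p ≤ d ∧ d ≤ p ∧ (d = p → β a = true) ∧
      (d = -p → β a = false) := by
  rcases h with h | h
  · obtain ⟨-, i, h1, h2, rfl | rfl⟩ := cyclePower_adj.1 h
    · exact ⟨i, by simp, by omega, by omega, by omega, by omega, by omega⟩
    · exact ⟨-i, by simp, by omega, by omega, by omega, by omega, by omega⟩
  · rcases halfShift_adj h with ⟨rfl, hb⟩ | ⟨rfl, hb⟩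
    · exact ⟨p, by simp, by omega, by omega, by omega, fun _ => hb, by omega⟩
    · exact ⟨-p, by simp, by omega, by omega, by omega, by omega, fun _ => by simp [hβ, hb]⟩

/-- The graph on two copies of the residues modulo `m` whose edges are the differences less than
`p`, half of the differences `p`, and a matching between the copies, locally embeds into the prism
over the complete graph on `2 * p` vertices. -/
theorem exists_extendsToTotal_covering {m p : ℕ} (hp : 2 ≤ p) (hm : 2 * p ∣ m)
    {β : ZMod m → Bool} (hβ : ∀ a, β (a + (p : ℕ)) = !β a) {f : ZMod m → ZMod m}
    (hf : Function.Involutive f)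
    (hfp : ∀ a, ZMod.castHom hm (ZMod (2 * p)) (f a) = ZMod.castHom hm (ZMod (2 * p)) a) :
    ∃ cv, ExtendsToTotal (twoCopies (cyclePower m (p - 1) ⊔ halfShift (p : ZMod m) β) ⊔
        crossGraph f) cv (2 * p + 1) ∧
      (∀ a b ε, ZMod.castHom hm (ZMod (2 * p)) a ≠ ZMod.castHom hm (ZMod (2 * p)) b →
        cv (a, ε) ≠ cv (b, ε)) ∧
      ∀ a b, ZMod.castHom hm (ZMod (2 * p)) a = ZMod.castHom hm (ZMod (2 * p)) b →
        cv (a, false) ≠ cv (b, true) := by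
  have : NeZero (2 * p) := ⟨by omega⟩
  set π := ZMod.castHom hm (ZMod (2 * p)) with hπ
  obtain ⟨cv, hcv⟩ := exists_extendsToTotal_completePrism (N := 2 * p + 1) ⟨p, rfl⟩ (by omega)
  -- The shift by one identifies the `2p` residues with the nonzero residues modulo `2p + 1`, the
  -- vertices of the prism.
  set pr : ZMod (2 * p) → ZMod (2 * p + 1) := fun a => ((a.val + 1 : ℕ) : ZMod (2 * p + 1))
    with hpr
  have pr0 : ∀ a, pr a ≠ 0 := fun a =>
    natCast_ne_zero_of_lt (Nat.succ_pos _) (Nat.succ_lt_succ (ZMod.val_lt a))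
  have pr_inj : Function.Injective pr := by
    intro a b hab
    have h := congrArg ZMod.val hab
    simp only [hpr] at h
    rw [ZMod.val_cast_of_lt (Nat.succ_lt_succ (ZMod.val_lt a)),
      ZMod.val_cast_of_lt (Nat.succ_lt_succ (ZMod.val_lt b))] at h
    exact ZMod.val_injective _ (Nat.succ_injective h)
  have hint : ∀ d d' : ℤ, (d : ZMod (2 * p)) = d' → (2 * p : ℤ) ∣ d' - d := fun d d' h => by
    have := (ZMod.intCast_eq_intCast_iff_dvd_sub d d' (2 * p)).1 h
    exact_mod_cast this
  have hprop := hcv.2.1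
  refine ⟨_, hcv.comap (fun u => (pr (π u.1), u.2)) ?_ ?_, ?_, ?_⟩
  · rintro ⟨a, ε⟩ ⟨b, δ⟩ (⟨h1, h2⟩ | ⟨h1, h2⟩) <;> refine ⟨pr0 _, pr0 _, ?_⟩
    · refine Or.inl ⟨h1, fun h => ?_⟩
      obtain ⟨d, h3, h4, h5, h6, -⟩ := exists_int_of_adj (by omega) hβ h2
      have h7 := pr_inj h
      simp only at h3 h7
      rw [h3, map_add, map_intCast, left_eq_add] at h7
      obtain ⟨c, hc⟩ := hint 0 d (by simp [h7])
      have : c = 0 := by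
        by_contra hc0
        rcases lt_or_gt_of_ne hc0 with h | h <;> nlinarith
      simp [this] at hc
      exact h4 hc
    · refine Or.inr ⟨h1, ?_⟩
      rcases h2 with h | h <;> simp only at h <;> simp [h, hfp]
  · rintro ⟨a, ε⟩ ⟨b, δ⟩ ⟨c, γ⟩ (⟨h1, h2⟩ | h1) (⟨h3, h4⟩ | h3) h
    · simp only [Prod.mk.injEq] at h h1 h2 h3 h4
      obtain ⟨d, rfl, h5, h6, h7, h8, h9⟩ := exists_int_of_adj (by omega) hβ h2
      obtain ⟨d', rfl, h5', h6', h7', h8', h9'⟩ := exists_int_of_adj (by omega) hβ h4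
      have h10 := pr_inj h.1
      rw [map_add, map_add, map_intCast, map_intCast, add_right_inj] at h10
      obtain ⟨x, hx⟩ := hint d d' h10
      have hx1 : -1 ≤ x := by
        by_contra hc
        nlinarith
      have hx2 : x ≤ 1 := by
        by_contra hc
        nlinarith
      -- Both differences lie in `[-p, p]`, so `x = ±1` forces them to be `p` and `-p` in some
      -- order, and then `β a` would have both values.
      have hx3 : x = -1 ∨ x = 0 ∨ x = 1 := by omega
      rcases hx3 with rfl | rfl | rfl
      · have h11 := h8 (by omega)
        rw [h9' (by omega)] at h11
        simp at h11
      · rw [show d' = d by omega, h.2]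
      · have h11 := h8' (by omega)
        rw [h9 (by omega)] at h11
        simp at h11
    · exact absurd (h1.trans (Prod.ext_iff.1 h).2) h3.1
    · exact absurd (h3.trans (Prod.ext_iff.1 h).2.symm) h1.1
    · exact crossGraph_matching hf _ _ _ h1 h3
  · exact fun a b ε hab => hprop _ _ ⟨pr0 _, pr0 _, Or.inl ⟨rfl, fun h => hab (pr_inj h)⟩⟩
  · exact fun a b hab => hprop _ _ ⟨pr0 _, pr0 _, Or.inr ⟨by simp, congrArg pr hab⟩⟩

end Covering

open TwoGyrogroup

/-! ### Colouring the models in the three ranges of `k` -/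

section Models

/-- Half of the residue modulus, as a residue. -/
abbrev halfRes (n : ℕ) : ZMod (half n) := ((half n / 2 : ℕ) : ZMod (half n))

/-- The involution that fixes the even residues and shifts the odd ones by half the modulus. -/
def twist (n : ℕ) (a : ZMod (half n)) : ZMod (half n) := a + halfRes n * a

/-- A model of the left Cayley graph. -/
abbrev leftModel (n k : ℕ) : SimpleGraph (ZMod (half n) × Bool) :=
  twoCopies (cyclePower (half n) k) ⊔ crossGraph (twist n)

/-- A model of the right Cayley graph. -/
abbrev rightModel (n k : ℕ) : SimpleGraph (ZMod (half n) × Bool) :=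
  leftModel n k ⊔ crossGraph id

/-- The left model has a total colouring with `N` colours in which the two copies of each residue
have different colours. -/
def ModelColorable (n k N : ℕ) : Prop :=
  ∃ cv, ExtendsToTotal (leftModel n k) cv N ∧ ∀ a, cv (a, false) ≠ cv (a, true)

variable {n k : ℕ}

theorem twist_involutive (hn : 3 ≤ n) : Function.Involutive (twist n) := by
  intro a
  simp only [twist]
  linear_combination a * two_mul_cast hn + a * cast_mul_cast hn

theorem ModelColorable.left {N : ℕ} (h : ModelColorable n k N) :
    TotalColorable (leftModel n k) N := by
  obtain ⟨cv, h, -⟩ := h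
  exact h.totalColorable

theorem ModelColorable.right {N : ℕ} (h : ModelColorable n k N) :
    TotalColorable (rightModel n k) (N + 1) := by
  obtain ⟨cv, h, h1⟩ := h
  refine (h.sup_matching (crossGraph_matching fun _ => rfl) ?_).totalColorable
  rintro ⟨a, ε⟩ ⟨b, δ⟩ ⟨h2, h3⟩
  obtain rfl : b = a := h3.elim id Eq.symm
  cases ε <;> cases δ
  · exact absurd rfl h2
  · exact h1 b
  · exact (h1 b).symm
  · exact absurd rfl h2

/-- The shift is by a multiple of `m/2`. Applied with `q = 2p` and `q = 2`, this makes the cross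
matching look like the identity after reduction. -/
theorem castHom_twist {q : ℕ} (hq : q ∣ half n) (hq' : q ∣ half n / 2) (a : ZMod (half n)) :
    ZMod.castHom hq (ZMod q) (twist n a) = ZMod.castHom hq (ZMod q) a := by
  have h : ((half n / 2 : ℕ) : ZMod q) = 0 := (ZMod.natCast_eq_zero_iff _ _).2 hq'
  rw [twist, map_add, map_mul, map_natCast, h, zero_mul, add_zero]

theorem half_div_two (hn : 3 ≤ n) : half n / 2 = 2 ^ (n - 2) := by
  rw [half, show n - 1 = (n - 2) + 1 by omega, pow_succ]
  omega

theorem modelColorable_of_lt (hn : 3 ≤ n) (hk : 2 ≤ k) (hkh : k < half n / 2) :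
    ModelColorable n k (2 * k + 2) := by
  -- Take the largest power of two up to `k`. The bound `k < 2p` keeps vertices at difference at
  -- most `k` distinct modulo `2p`; the divisibility makes `twist` trivial modulo `2p`; and `2 ≤ p`
  -- gives the prism lemma its `5 ≤ 2p + 1`.
  obtain ⟨p, hp, hpk, hkp, hdvd⟩ : ∃ p, 2 ≤ p ∧ p ≤ k ∧ k < 2 * p ∧ 2 * p ∣ half n / 2 := by
    have h1 : 2 ^ Nat.log 2 k ≤ k := Nat.pow_log_le_self 2 (by omega)
    have h2 : k < 2 ^ (Nat.log 2 k + 1) := Nat.lt_pow_succ_log_self (by norm_num) k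
    have h3 : 1 ≤ Nat.log 2 k := Nat.log_pos (by norm_num) hk
    rw [half_div_two hn] at hkh ⊢
    have h4 : Nat.log 2 k < n - 2 :=
      (Nat.pow_lt_pow_iff_right (by norm_num)).1 (h1.trans_lt hkh)
    rw [pow_succ'] at h2
    refine ⟨2 ^ Nat.log 2 k, ?_, h1, h2, ?_⟩
    · simpa using Nat.pow_le_pow_right (n := 2) (by norm_num) h3
    · rw [← pow_succ']
      exact pow_dvd_pow 2 h4
  have hm : 2 * p ∣ half n := by
    obtain ⟨r, hr⟩ := half_eq hn
    exact hdvd.trans ⟨2, by omega⟩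
  obtain ⟨β, hβ⟩ := exists_alternating (t := n - 1) (j := p) (by omega)
    (show p < half n by omega)
  obtain ⟨cv, h1, h2, h3⟩ := exists_extendsToTotal_covering hp hm hβ (twist_involutive hn)
    (castHom_twist hm hdvd)
  have hne : ∀ a ε (i : ℕ), 0 < i → i < 2 * p →
      cv (a, ε) ≠ cv (a + (i : ZMod (half n)), ε) := by
    intro a ε i hi hip
    refine h2 _ _ _ fun h => natCast_ne_zero_of_lt hi hip ?_
    rwa [map_add, map_natCast, left_eq_add] at h
  -- The vertex colouring stays fixed while edges are added by induction on `k`, starting at `p`.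
  refine ⟨cv, ?_, fun a => h3 a a rfl⟩
  induction k, hpk using Nat.le_induction with
  | base =>
    -- The complementary half of difference `p` takes the colour number `2p + 2`.
    have h4 := h1.sup_matching (twoCopies_matching (halfShift_matching (j := (p : ZMod (half n)))
      (β := fun a => !β a) fun a => congrArg not (hβ a))) ?_
    · refine h4.mono (sup_le ?_ (le_sup_right.trans le_sup_left))
      have h5 := twoCopies_mono (cyclePower_succ_le (m := half n) (k := p - 1) β)
      rw [show p - 1 + 1 = p by omega, twoCopies_sup] at h5
      exact h5.trans (sup_le_sup_right le_sup_left _)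
    · rintro ⟨a, ε⟩ ⟨b, δ⟩ ⟨h5, h6⟩
      simp only at h5 h6
      subst h5
      rcases halfShift_adj h6 with ⟨rfl, -⟩ | ⟨rfl, -⟩
      exacts [hne _ _ _ (by omega) (by omega), (hne _ _ _ (by omega) (by omega)).symm]
  | succ j hj ih =>
    exact (ih (by omega) (by omega) (by omega)).cyclePower_succ
      (show j + 1 < half n by omega) fun a ε => hne a ε _ (by omega) (by omega)

/-- Two colours for the vertices by parity, exchanged in the second copy; two for the cycle edges;
one for the matching. As `m/2` is even, the matching preserves parity, so its ends differ in colour.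
-/
theorem modelColorable_one (hn : 3 ≤ n) : ModelColorable n 1 5 := by
  obtain ⟨r, hr⟩ := half_eq hn
  have h4 := four_le_half hn
  have hm : 2 ∣ half n := ⟨2 * r, by omega⟩
  have hh : 2 ∣ half n / 2 := ⟨r, by omega⟩
  set π := ZMod.castHom hm (ZMod 2)
  have key : ∀ x : ZMod 2, x ≠ x + 1 := by decide
  have key' : ∀ x y : ZMod 2, x ≠ y → x.val ≠ y.val := fun x y hxy h =>
    hxy (ZMod.val_injective 2 h)
  set cv : ZMod (half n) × Bool → ℕ := fun u => (π u.1 + if u.2 then 1 else 0).val with hcv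
  -- The edgeless graph, with `⊥` as the extra summand, lets `ExtendsToTotal.cyclePower_succ` supply
  -- the cycles.
  have h0 : ExtendsToTotal (twoCopies (cyclePower (half n) 0) ⊔ ⊥) cv 2 := by
    have hno : ∀ u v, ¬ (twoCopies (cyclePower (half n) 0) ⊔ ⊥).Adj u v := by
      rintro u v (⟨-, h⟩ | h)
      · obtain ⟨-, i, h1, h2, -⟩ := cyclePower_adj.1 h
        omega
      · exact h
    exact ⟨fun v => ZMod.val_lt _, fun u v h => (hno u v h).elim, fun _ _ => 0,
      fun u v h => (hno u v h).elim⟩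
  have h1 := h0.cyclePower_succ (show 0 + 1 < half n by omega) fun a ε => by
    refine key' _ _ ?_
    simp only [Nat.zero_add, Nat.cast_one, map_add, map_one]
    rw [add_right_comm]
    exact key _
  refine ⟨cv, (h1.sup_matching (crossGraph_matching (twist_involutive hn)) ?_).mono ?_, ?_⟩
  · rintro ⟨a, ε⟩ ⟨b, δ⟩ ⟨h2, h3⟩
    refine key' _ _ ?_
    have h5 : π b = π a := by
      rcases h3 with h | h <;> simp only at h <;> rw [h] <;> simp [π, castHom_twist hm hh]
    simp only at h2 ⊢
    rw [h5]
    cases ε <;> cases δ <;> simp at h2 ⊢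
  · exact sup_le_sup_right le_sup_left _
  · intro a
    refine key' _ _ ?_
    simp

theorem cyclePower_adj_of_ne (hn : 3 ≤ n) (hk : half n / 2 ≤ k) {a b : ZMod (half n)}
    (hab : a ≠ b) : (cyclePower (half n) k).Adj a b := by
  obtain ⟨r, hr⟩ := half_eq hn
  have hpos := half_pos n
  have : NeZero (half n) := ⟨hpos.ne'⟩
  have hv := ZMod.val_lt (b - a)
  have h0 : (b - a).val ≠ 0 := by
    rw [Ne, ZMod.val_eq_zero, sub_eq_zero]
    exact hab.symm
  have hc : ((b - a).val : ZMod (half n)) = b - a := ZMod.natCast_zmod_val _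
  refine cyclePower_adj.2 ⟨hab, ?_⟩
  rcases le_or_gt (b - a).val (half n / 2) with h | h
  · exact ⟨_, by omega, h.trans hk, Or.inl (by rw [hc]; ring)⟩
  · refine ⟨half n - (b - a).val, by omega, by omega, Or.inr ?_⟩
    rw [Nat.cast_sub hv.le, hc, ZMod.natCast_self]
    ring

/-- The graph is complete here, so distinct residues have distinct colours and translation by `1` is
an automorphism. Using the translate on the second copy, matched vertices carry the colours of
residues of opposite parity, because `twist` preserves parity. -/
theorem ExtendsToTotal.modelColorable (hn : 3 ≤ n) (hk : half n / 2 ≤ k)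
    {cv : ZMod (half n) → ℕ} {N : ℕ} (h : ExtendsToTotal (cyclePower (half n) k) cv N) :
    ModelColorable n k (N + 1) := by
  obtain ⟨r, hr⟩ := half_eq hn
  have h4 := four_le_half hn
  have hm : 2 ∣ half n := ⟨2 * r, by omega⟩
  have hh : 2 ∣ half n / 2 := ⟨r, by omega⟩
  set p : ZMod (half n) × Bool → ZMod (half n) := fun u => u.1 + if u.2 then 1 else 0 with hp
  have h1 : ExtendsToTotal (twoCopies (cyclePower (half n) k)) (cv ∘ p) N := by
    refine h.comap p ?_ ?_
    · rintro ⟨a, ε⟩ ⟨b, δ⟩ ⟨h1, h2⟩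
      simp only at h1 h2
      subst h1
      refine cyclePower_adj_of_ne hn hk fun h => h2.ne ?_
      exact add_right_cancel h
    · rintro ⟨a, ε⟩ ⟨b, δ⟩ ⟨c, γ⟩ ⟨h1, h2⟩ ⟨h3, h4⟩ h
      simp only at h1 h3
      subst h1 h3
      exact congrArg (·, ε) (add_right_cancel h)
  have hne : ∀ a b : ZMod (half n),
      ZMod.castHom hm (ZMod 2) a = ZMod.castHom hm (ZMod 2) b → cv a ≠ cv (b + 1) := by
    intro a b hab
    refine h.2.1 _ _ (cyclePower_adj_of_ne hn hk ?_)
    rintro rfl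
    have key : ∀ x : ZMod 2, x + 1 ≠ x := by decide
    rw [map_add, map_one] at hab
    exact key _ hab
  refine ⟨cv ∘ p, h1.sup_matching (crossGraph_matching (twist_involutive hn)) ?_, fun a => ?_⟩
  · rintro ⟨a, ε⟩ ⟨b, δ⟩ ⟨h2, h3⟩
    have h5 : ZMod.castHom hm (ZMod 2) b = ZMod.castHom hm (ZMod 2) a := by
      rcases h3 with h | h <;> simp only at h <;> rw [h, castHom_twist hm hh]
    cases ε <;> cases δ
    · exact absurd rfl h2
    · simpa [hp] using hne a b h5.symm
    · simpa [hp] using (hne b a h5).symm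
    · exact absurd rfl h2
  · simpa [hp] using hne a a rfl

/-- Colour by sums modulo `m + 1`, with vertex `a` receiving `2a`; since `m + 1` is odd, doubling is
injective. This works already for the complete graph. -/
theorem exists_extendsToTotal_of_even {m : ℕ} (hm : Even m) (hpos : 0 < m)
    (H : SimpleGraph (ZMod m)) : ∃ cv, ExtendsToTotal H cv (m + 1) := by
  have : NeZero m := ⟨hpos.ne'⟩
  obtain ⟨r, rfl⟩ := hm
  have hval : ∀ a b : ZMod (r + r), a ≠ b → a.val ≠ b.val := fun a b hab h =>
    hab (ZMod.val_injective _ h)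
  have hcancel : ∀ x y z : ℕ, x < r + r → y < r + r → x ≠ y →
      (z + x) % (r + r + 1) ≠ (z + y) % (r + r + 1) := by
    intro x y z hx hy hxy h
    have h' : x ≡ y [MOD r + r + 1] := Nat.ModEq.add_left_cancel' z h
    exact hxy (h'.eq_of_lt_of_lt (by omega) (by omega))
  refine ⟨fun a => (a.val + a.val) % (r + r + 1), fun v => Nat.mod_lt _ (by omega), ?_,
    fun a b => (a.val + b.val) % (r + r + 1), fun a b hab => ⟨by beta_reduce; rw [add_comm a.val],
      Nat.mod_lt _ (by omega), hcancel _ _ _ (ZMod.val_lt _) (ZMod.val_lt _) (hval _ _ hab.ne),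
      fun c _ hbc => hcancel _ _ _ (ZMod.val_lt _) (ZMod.val_lt _) (hval _ _ hbc)⟩⟩
  intro a b hab h
  have ha := ZMod.val_lt a
  have hb := ZMod.val_lt b
  have h' : 2 * a.val ≡ 2 * b.val [MOD r + r + 1] := by
    rw [two_mul, two_mul]
    exact h
  have h1 := Nat.ModEq.cancel_left_of_coprime (c := 2)
    (by rw [Nat.gcd_comm]; exact Nat.coprime_two_left.2 ⟨r, by ring⟩) h'
  exact hval _ _ hab.ne (h1.eq_of_lt_of_lt (by omega) (by omega))

/-- A cycle whose length is not a multiple of three has no total colouring with three colours. -/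
theorem not_totalColorable_cycle {m : ℕ} (hm : 3 ≤ m) (h3 : Nat.Coprime 3 m) :
    ¬ TotalColorable (cyclePower m 1) 3 := by
  intro hc
  obtain ⟨cv, hlt, hv, ce, hce⟩ := hc.exists_extendsToTotal
  have h1 : (1 : ZMod m) ≠ 0 := by
    exact_mod_cast natCast_ne_zero_of_lt (m := m) (i := 1) (by omega) (by omega)
  have h2 : (2 : ZMod m) ≠ 0 := by
    exact_mod_cast natCast_ne_zero_of_lt (m := m) (i := 2) (by omega) (by omega)
  have hadj : ∀ a : ZMod m, (cyclePower m 1).Adj a (a + 1) := fun a =>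
    cyclePower_adj.2 ⟨by simpa using h1, 1, le_rfl, le_rfl, Or.inl (by simp)⟩
  -- Along the alternating sequence of vertices and edges, three consecutive elements conflict
  -- pairwise and so use all three colours. Hence the sequence of colours has period three.
  have hstep : ∀ a, ce (a + 1) (a + 1 + 1) = cv a ∧ cv (a + 1 + 1) = ce a (a + 1) := by
    intro a
    have a1 := hlt a
    have a2 := hlt (a + 1)
    have a3 := hlt (a + 1 + 1)
    have a4 := hv _ _ (hadj a)
    have a5 := hv _ _ (hadj (a + 1))
    obtain ⟨b1, b2, b3, -⟩ := hce _ _ (hadj a)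
    obtain ⟨c1, c2, c3, -⟩ := hce _ _ (hadj (a + 1))
    obtain ⟨-, -, d3, d4⟩ := hce _ _ (hadj a).symm
    obtain ⟨-, -, e3, -⟩ := hce _ _ (hadj (a + 1)).symm
    have hne : a ≠ a + 1 + 1 := by
      intro h
      apply h2
      linear_combination -h
    have d5 := d4 _ (hadj (a + 1)) hne
    omega
  have hper : ∀ a, cv (a + 3) = cv a := by
    intro a
    rw [← (hstep a).1, ← (hstep (a + 1)).2]
    congr 1
    ring
  have hper' : ∀ (i : ℕ), cv (3 * i) = cv 0 := by
    intro i
    induction i with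
    | zero => simp
    | succ i ih => rw [← ih, ← hper (3 * (i : ZMod m))]; congr 1; push_cast; ring
  have : NeZero m := ⟨by omega⟩
  -- As `3` is invertible modulo `m`, steps of three lead from `0` to its neighbour `1`, which would
  -- share its colour.
  have h5 := hper' ((3 : ZMod m)⁻¹).val
  rw [ZMod.natCast_zmod_val] at h5
  have h6 : (3 : ZMod m) * (3 : ZMod m)⁻¹ = 1 := by
    exact_mod_cast ZMod.coe_mul_inv_eq_one 3 h3
  rw [h6] at h5
  have h7 := hadj 0
  rw [zero_add] at h7
  exact hv _ _ h7 h5.symm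

end Models

/-! ### Degree bounds -/

section Degrees

variable {n k : ℕ}

theorem exists_differences_of_lt (hn : 3 ≤ n) (hk : k < half n / 2) :
    ∃ s : Finset (ZMod (half n)), s.card = 2 * k ∧
      ∀ a, ∀ b ∈ s, (cyclePower (half n) k).Adj a (a + b) := by
  obtain ⟨r, hr⟩ := half_eq hn
  have hinj : ∀ i j : ℕ, i < half n → j < half n →
      (i : ZMod (half n)) = j → i = j := by
    intro i j hi hj hij
    exact Nat.ModEq.eq_of_lt_of_lt ((ZMod.natCast_eq_natCast_iff _ _ _).1 hij) hi hj
  refine ⟨(Finset.Icc 1 k ∪ Finset.Ico (half n - k) (half n)).image Nat.cast, ?_, ?_⟩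
  · rw [Finset.card_image_of_injOn, Finset.card_union_of_disjoint]
    · simp only [Nat.card_Icc, Nat.card_Ico]
      omega
    · rw [Finset.disjoint_left]
      intro x hx hx'
      simp only [Finset.mem_Icc, Finset.mem_Ico] at hx hx'
      omega
    · intro i hi j hj hij
      simp only [Finset.coe_union, Finset.coe_Icc, Finset.coe_Ico, Set.mem_union, Set.mem_Icc,
        Set.mem_Ico] at hi hj
      exact hinj i j (by omega) (by omega) hij
  · intro a b hb
    simp only [Finset.mem_image, Finset.mem_union, Finset.mem_Icc, Finset.mem_Ico] at hb
    obtain ⟨i, hi, rfl⟩ := hb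
    refine cyclePower_adj.2 ⟨?_, ?_⟩
    · simpa using (natCast_ne_zero_of_lt (m := half n) (i := i) (by omega) (by omega))
    · rcases hi with hi | hi
      · exact ⟨i, hi.1, hi.2, Or.inl rfl⟩
      · refine ⟨half n - i, by omega, by omega, Or.inr ?_⟩
        rw [Nat.cast_sub (by omega), ZMod.natCast_self]
        ring

theorem exists_differences_of_ge (hn : 3 ≤ n) (hk : half n / 2 ≤ k) :
    ∃ s : Finset (ZMod (half n)), s.card = half n - 1 ∧
      ∀ a, ∀ b ∈ s, (cyclePower (half n) k).Adj a (a + b) := by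
  have : NeZero (half n) := ⟨(half_pos n).ne'⟩
  refine ⟨Finset.univ.erase 0, ?_, fun a b hb => cyclePower_adj_of_ne hn hk ?_⟩
  · rw [Finset.card_erase_of_mem (Finset.mem_univ _), Finset.card_univ, ZMod.card]
  · simpa using Finset.ne_of_mem_erase hb

theorem leftModel_neighbors {s : Finset (ZMod (half n))}
    (hs : ∀ a, ∀ b ∈ s, (cyclePower (half n) k).Adj a (a + b)) :
    ∃ v, ∃ s' : Finset (ZMod (half n) × Bool), s'.card = s.card + 1 ∧
      ∀ w ∈ s', (leftModel n k).Adj v w := by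
  have hinj : Function.Injective fun b : ZMod (half n) => ((1 : ZMod (half n)) + b, false) :=
    fun b c h => add_left_cancel (Prod.ext_iff.1 h).1
  refine ⟨(1, false), insert (twist n 1, true) (s.image fun b => (1 + b, false)), ?_, ?_⟩
  · rw [Finset.card_insert_of_notMem (by simp), Finset.card_image_of_injective _ hinj]
  · intro w hw
    rcases Finset.mem_insert.1 hw with rfl | hw
    · exact Or.inr ⟨by simp, Or.inl rfl⟩
    · obtain ⟨b, hb, rfl⟩ := Finset.mem_image.1 hw
      exact Or.inl ⟨rfl, hs 1 b hb⟩

/-- The base point must be odd: `twist` fixes even residues, where the two cross edges coincide,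
whereas `twist 1 = 1 + m/2 ≠ 1`. -/
theorem rightModel_neighbors (hn : 3 ≤ n) {s : Finset (ZMod (half n))}
    (hs : ∀ a, ∀ b ∈ s, (cyclePower (half n) k).Adj a (a + b)) :
    ∃ v, ∃ s' : Finset (ZMod (half n) × Bool), s'.card = s.card + 2 ∧
      ∀ w ∈ s', (rightModel n k).Adj v w := by
  have hinj : Function.Injective fun b : ZMod (half n) => ((1 : ZMod (half n)) + b, false) :=
    fun b c h => add_left_cancel (Prod.ext_iff.1 h).1
  have h4 := four_le_half hn
  have hh : halfRes n ≠ 0 := natCast_ne_zero_of_lt (by omega) (by omega)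
  refine ⟨(1, false), insert (1, true) (insert (twist n 1, true)
    (s.image fun b => (1 + b, false))), ?_, ?_⟩
  · rw [Finset.card_insert_of_notMem (by simpa [twist] using hh),
      Finset.card_insert_of_notMem (by simp), Finset.card_image_of_injective _ hinj]
  · intro w hw
    rcases Finset.mem_insert.1 hw with rfl | hw
    · exact Or.inr ⟨by simp, Or.inl rfl⟩
    rcases Finset.mem_insert.1 hw with rfl | hw
    · exact Or.inl (Or.inr ⟨by simp, Or.inl rfl⟩)
    · obtain ⟨b, hb, rfl⟩ := Finset.mem_image.1 hw
      exact Or.inl (Or.inl ⟨rfl, hs 1 b hb⟩)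

theorem maxDeg_cycle_le {m : ℕ} [NeZero m] : maxDeg (cyclePower m 1) ≤ 2 := by
  classical
  refine SimpleGraph.maxDegree_le_of_forall_degree_le _ _ fun v => ?_
  rw [← SimpleGraph.card_neighborFinset_eq_degree]
  refine (Finset.card_le_card fun w hw => ?_).trans (Finset.card_le_two (a := v + 1) (b := v - 1))
  rw [SimpleGraph.mem_neighborFinset] at hw
  obtain ⟨-, i, h1, h2, h3⟩ := cyclePower_adj.1 hw
  obtain rfl : i = 1 := by omega
  rw [Finset.mem_insert, Finset.mem_singleton]
  rcases h3 with h3 | h3 <;> simp [h3]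

theorem maxDeg_cyclePower_lt {m : ℕ} [NeZero m] : maxDeg (cyclePower m k) + 1 ≤ m := by
  classical
  have h := (cyclePower m k).maxDegree_lt_card_verts
  rw [ZMod.card] at h
  exact h

end Degrees

/-! ### Colour counts against degrees -/

section Transfer

variable {n k : ℕ} {V : Type*} [Fintype V] [Nonempty V]

/-- Here `D` is a number of neighbours in the cycle power, obtained from differences independent of
the vertex. The cross edges raise it to `D + 1` in the left model and `D + 2` in the right one, so
`D + 3` and `D + 2` are the budgets for TCC and type I. -/
theorem exists_modelColorable (hn : 3 ≤ n) (hk : 1 ≤ k) :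
    ∃ D N : ℕ, (∃ s : Finset (ZMod (half n)), s.card = D ∧
      ∀ a, ∀ b ∈ s, (cyclePower (half n) k).Adj a (a + b)) ∧
      ModelColorable n k N ∧ N ≤ D + 3 ∧
      (IsTypeI (cyclePower (half n) k) → ∃ N', ModelColorable n k N' ∧ N' ≤ D + 2) := by
  obtain ⟨r, hr⟩ := half_eq hn
  have h4 := four_le_half hn
  have : NeZero (half n) := ⟨(half_pos n).ne'⟩
  rcases le_or_gt (half n / 2) k with hkh | hkh
  · obtain ⟨cv, hcv⟩ := exists_extendsToTotal_of_even (m := half n) ⟨2 * r, by omega⟩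
      (by omega) (cyclePower (half n) k)
    refine ⟨_, _, exists_differences_of_ge hn hkh, hcv.modelColorable hn hkh, by omega,
      fun hI => ?_⟩
    obtain ⟨cv, hcv⟩ := hI.totalColorable.exists_extendsToTotal
    have := maxDeg_cyclePower_lt (m := half n) (k := k)
    exact ⟨_, hcv.modelColorable hn hkh, by omega⟩
  · rcases hk.eq_or_lt with rfl | hk
    · refine ⟨_, _, exists_differences_of_lt hn hkh, modelColorable_one hn, by omega,
        fun hI => ?_⟩
      have hc : Nat.Coprime 3 (half n) := Nat.Coprime.pow_right _ (by norm_num)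
      refine absurd (hI.totalColorable.mono ?_) (not_totalColorable_cycle (by omega) hc)
      have := maxDeg_cycle_le (m := half n)
      omega
    · exact ⟨_, _, exists_differences_of_lt hn hkh, modelColorable_of_lt hn hk hkh, by omega,
        fun _ => ⟨_, modelColorable_of_lt hn hk hkh, le_rfl⟩⟩

theorem leftModel_conclusions (hn : 3 ≤ n) (hk : 1 ≤ k) {G : SimpleGraph V}
    (e : G ≃g leftModel n k) :
    SatisfiesTCC G ∧ (IsTypeI (cyclePower (half n) k) → IsTypeI G) := by
  have : NeZero (half n) := ⟨(half_pos n).ne'⟩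
  obtain ⟨D, N, ⟨s, hs, hadj⟩, hN, hND, hI⟩ := exists_modelColorable hn hk
  obtain ⟨v, s', hs', hadj'⟩ := leftModel_neighbors hadj
  have hdeg := le_maxDeg_of_iso e v s' hadj'
  refine ⟨(hN.left.of_iso e).satisfiesTCC (by omega), fun h => ?_⟩
  obtain ⟨N', h1, h2⟩ := hI h
  exact (h1.left.of_iso e).isTypeI (by omega)

theorem rightModel_conclusions (hn : 3 ≤ n) (hk : 1 ≤ k) {G : SimpleGraph V}
    (e : G ≃g rightModel n k) :
    SatisfiesTCC G ∧ (IsTypeI (cyclePower (half n) k) → IsTypeI G) := by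
  have : NeZero (half n) := ⟨(half_pos n).ne'⟩
  obtain ⟨D, N, ⟨s, hs, hadj⟩, hN, hND, hI⟩ := exists_modelColorable hn hk
  obtain ⟨v, s', hs', hadj'⟩ := rightModel_neighbors hn hadj
  have hdeg := le_maxDeg_of_iso e v s' hadj'
  refine ⟨(hN.right.of_iso e).satisfiesTCC (by omega), fun h => ?_⟩
  obtain ⟨N', h1, h2⟩ := hI h
  exact (h1.right.of_iso e).isTypeI (by omega)

end Transfer

/-! ### Identifying the Cayley graphs with the models -/

section Coordinates

variable {n k : ℕ}

theorem code_bijective (hn : 3 ≤ n) :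
    Function.Bijective fun x : Fin (2 ^ n) => code (half n) x := by
  have h := two_pow_eq hn
  have : NeZero (half n) := ⟨(half_pos n).ne'⟩
  refine (Fintype.bijective_iff_injective_and_card _).2 ⟨fun x y hxy => ?_, ?_⟩
  · exact Fin.ext (code_inj (by omega) (by omega) hxy)
  · rw [Fintype.card_fin, Fintype.card_prod, ZMod.card, Fintype.card_bool]
    omega

/-- Elements as pairs of a residue and a half. -/
noncomputable def codeEquiv (hn : 3 ≤ n) : Fin (2 ^ n) ≃ ZMod (half n) × Bool :=
  Equiv.ofBijective _ (code_bijective hn)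

theorem codeEquiv_add (hn : 3 ≤ n) (x y : Fin (2 ^ n)) :
    codeEquiv hn ((twoGyrogroup n hn).add x y) =
      addR (halfRes n) (codeEquiv hn x) (codeEquiv hn y) :=
  code_addNat (by have := four_le_half hn; omega) x y

theorem mem_T₁_iff (hn : 3 ≤ n) (x : Fin (2 ^ n)) : x ∈ T₁ n ↔ (codeEquiv hn x).2 = false := by
  simp [T₁, codeEquiv, code]

theorem mem_T₂_iff (hn : 3 ≤ n) (x : Fin (2 ^ n)) : x ∈ T₂ n ↔ (codeEquiv hn x).2 = true := by
  simp [T₂, codeEquiv, code]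

theorem codeEquiv_reflection (hn : 3 ≤ n) :
    codeEquiv hn (reflection n hn) = (halfRes n, true) := by
  simp [codeEquiv, code, reflection]

theorem mem_genSet_iff (hn : 3 ≤ n) (hkm : k < half n) (s : Fin (2 ^ n)) :
    s ∈ genSet n k ↔
      (∃ i : ℕ, 1 ≤ i ∧ i ≤ k ∧
        (codeEquiv hn s = ((i : ZMod (half n)), false) ∨
          codeEquiv hn s = (-(i : ZMod (half n)), false))) ∨
      codeEquiv hn s = (halfRes n, true) := by
  have h2 := two_pow_eq hn
  have hlt : ∀ i : ℕ, i < half n → codeEquiv hn s = ((i : ZMod (half n)), false) →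
      s.val = i := by
    intro i hi h
    exact code_inj (by omega) (by omega) (h.trans (code_lt hi).symm)
  constructor
  · rintro (⟨h3, h4⟩ | ⟨h3, h4⟩ | h3)
    · exact Or.inl ⟨s, h3, h4, Or.inl (code_lt (by omega))⟩
    · refine Or.inl ⟨half n - s, by omega, by omega, Or.inr ?_⟩
      have h5 : codeEquiv hn s = ((s.val : ZMod (half n)), false) := code_lt (by omega)
      rw [h5, Nat.cast_sub (by omega), ZMod.natCast_self]
      simp
    · right
      rw [← codeEquiv_reflection hn, show s = reflection n hn from Fin.ext h3]
  · rintro (⟨i, h3, h4, h5 | h5⟩ | h3)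
    · have := hlt i (by omega) h5
      exact Or.inl ⟨by omega, by omega⟩
    · have := hlt (half n - i) (by omega) (by
        rw [h5, Nat.cast_sub (by omega), ZMod.natCast_self, zero_sub])
      exact Or.inr (Or.inl ⟨by omega, by omega⟩)
    · rw [← codeEquiv_reflection hn] at h3
      rw [(codeEquiv hn).injective h3]
      exact Or.inr (Or.inr rfl)

/-- The adjacency of distinct residues in the power of the cycle. -/
def NearBy (n k : ℕ) (a b : ZMod (half n)) : Prop :=
  ∃ i : ℕ, 1 ≤ i ∧ i ≤ k ∧ (b = a + i ∨ a = b + i)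

theorem NearBy.symm {a b : ZMod (half n)} (h : NearBy n k a b) : NearBy n k b a := by
  obtain ⟨i, h1, h2, h3⟩ := h
  exact ⟨i, h1, h2, h3.symm⟩

/-- Replaces quantification over generators by residues `±i` and the single element `(m/2, true)`,
so that adjacency becomes ring arithmetic. -/
theorem exists_genSet_iff (hn : 3 ≤ n) (hkm : k < half n) (p : ZMod (half n) × Bool → Prop) :
    (∃ s ∈ genSet n k, p (codeEquiv hn s)) ↔
      (∃ i : ℕ, 1 ≤ i ∧ i ≤ k ∧ (p ((i : ZMod (half n)), false) ∨
        p (-(i : ZMod (half n)), false))) ∨ p (halfRes n, true) := by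
  constructor
  · rintro ⟨s, hs, hp⟩
    rcases (mem_genSet_iff hn hkm s).1 hs with ⟨i, h1, h2, h3 | h3⟩ | h3
    · exact Or.inl ⟨i, h1, h2, Or.inl (h3 ▸ hp)⟩
    · exact Or.inl ⟨i, h1, h2, Or.inr (h3 ▸ hp)⟩
    · exact Or.inr (h3 ▸ hp)
  · have key : ∀ c, p c → codeEquiv hn ((codeEquiv hn).symm c) = c ∧
        p (codeEquiv hn ((codeEquiv hn).symm c)) := fun c hc => by
      rw [Equiv.apply_symm_apply]; exact ⟨rfl, hc⟩
    rintro (⟨i, h1, h2, h3 | h3⟩ | h3)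
    · exact ⟨_, (mem_genSet_iff hn hkm _).2 (Or.inl ⟨i, h1, h2, Or.inl (key _ h3).1⟩),
        (key _ h3).2⟩
    · exact ⟨_, (mem_genSet_iff hn hkm _).2 (Or.inl ⟨i, h1, h2, Or.inr (key _ h3).1⟩),
        (key _ h3).2⟩
    · exact ⟨_, (mem_genSet_iff hn hkm _).2 (Or.inr (key _ h3).1), (key _ h3).2⟩

/-- Applying a permutation to the second copy. -/
def permSecond {W : Type*} (u : Equiv.Perm W) : W × Bool ≃ W × Bool where
  toFun x := (if x.2 then u x.1 else x.1, x.2)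
  invFun x := (if x.2 then u.symm x.1 else x.1, x.2)
  left_inv := by rintro ⟨a, _ | _⟩ <;> simp
  right_inv := by rintro ⟨a, _ | _⟩ <;> simp

/-- With `h = m/2` one has `2h = h² = 0`, so `(h - 1)² = 1`. The flip undoes the factor `h - 1` by
which right translation acts on `T₂`: a step `(h - 1) i` becomes `-i`. It also turns `x ⊕ r` into
`twist` for `x ∈ T₁` and into the identity for `x ∈ T₂`. -/
theorem rightFlip_involutive (hn : 3 ≤ n) :
    Function.Involutive fun b : ZMod (half n) => halfRes n - (halfRes n - 1) * b := by
  intro b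
  simp only
  linear_combination (1 - b) * two_mul_cast hn + (b - 1) * cast_mul_cast hn

/-- Coordinates in which the left Cayley graph is the left model. -/
noncomputable def leftCoord (hn : 3 ≤ n) : Fin (2 ^ n) ≃ ZMod (half n) × Bool :=
  (codeEquiv hn).trans (permSecond (Equiv.subLeft (halfRes n)))

/-- Coordinates in which the right Cayley graph is the right model. -/
noncomputable def rightCoord (hn : 3 ≤ n) : Fin (2 ^ n) ≃ ZMod (half n) × Bool :=
  (codeEquiv hn).trans (permSecond (rightFlip_involutive hn).toPerm)

/-- Left translation by the generators, in coordinates. -/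
theorem exists_left_iff (hn : 3 ≤ n) (hkm : k < half n) (x y : Fin (2 ^ n)) :
    (∃ s ∈ genSet n k, y = (twoGyrogroup n hn).add s x) ↔
      ((leftCoord hn x).2 = (leftCoord hn y).2 ∧
        NearBy n k (leftCoord hn x).1 (leftCoord hn y).1) ∨
      ((leftCoord hn x).2 ≠ (leftCoord hn y).2 ∧
        (leftCoord hn y).1 = twist n (leftCoord hn x).1) := by
  have h1 := exists_genSet_iff hn hkm fun c =>
    codeEquiv hn y = addR (halfRes n) c (codeEquiv hn x)
  simp only [← codeEquiv_add, (codeEquiv hn).injective.eq_iff] at h1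
  simp only [← (codeEquiv hn).injective.eq_iff, codeEquiv_add] at h1 ⊢
  rw [h1]
  -- Reflecting the second copy by `b ↦ h - b` sends `r ⊕ a = h + (h - 1) a` to `a - h a`, which is
  -- `twist a` because `2h = 0`.
  simp only [leftCoord, Equiv.trans_apply]
  have e2 := two_mul_cast hn
  have ee := cast_mul_cast hn
  generalize codeEquiv hn x = X
  generalize codeEquiv hn y = Y
  obtain ⟨a, ε⟩ := X
  obtain ⟨b, δ⟩ := Y
  cases ε <;> cases δ <;> simp [addR, permSecond, NearBy, twist]
  · refine exists_congr fun i => and_congr_right fun _ => and_congr_right fun _ => ?_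
    exact or_congr ⟨fun h => by linear_combination h, fun h => by linear_combination h⟩
      ⟨fun h => by linear_combination -h, fun h => by linear_combination -h⟩
  · exact ⟨fun h => by linear_combination -h - a * e2, fun h => by linear_combination -h - a * e2⟩
  · exact ⟨fun h => by linear_combination h + a * e2, fun h => by linear_combination h - a * e2⟩
  · refine exists_congr fun i => and_congr_right fun _ => and_congr_right fun _ => ?_
    rw [or_comm]
    exact or_congr ⟨fun h => by linear_combination -h, fun h => by linear_combination -h⟩
      ⟨fun h => by linear_combination h, fun h => by linear_combination h⟩

/-- Right translation by the generators, in coordinates. -/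
theorem exists_right_iff (hn : 3 ≤ n) (hkm : k < half n) (x y : Fin (2 ^ n))
    (q : Prop) :
    (∃ s ∈ genSet n k, y = (twoGyrogroup n hn).add x s ∧ (s = reflection n hn → x ∈ T₁ n ∨ q)) ↔
      ((rightCoord hn x).2 = (rightCoord hn y).2 ∧
        NearBy n k (rightCoord hn x).1 (rightCoord hn y).1) ∨
      ((rightCoord hn x).2 = false ∧ (rightCoord hn y).2 = true ∧
        (rightCoord hn y).1 = twist n (rightCoord hn x).1) ∨
      ((rightCoord hn x).2 = true ∧ (rightCoord hn y).2 = false ∧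
        (rightCoord hn y).1 = (rightCoord hn x).1 ∧ q) := by
  have h1 := exists_genSet_iff hn hkm fun c =>
    codeEquiv hn y = addR (halfRes n) (codeEquiv hn x) c ∧
      (c = (halfRes n, true) → x ∈ T₁ n ∨ q)
  simp only [← (codeEquiv hn).injective.eq_iff, codeEquiv_add, codeEquiv_reflection,
    mem_T₁_iff hn] at h1 ⊢
  rw [h1]
  simp only [rightCoord, Equiv.trans_apply]
  have e2 := two_mul_cast hn
  have ee := cast_mul_cast hn
  generalize codeEquiv hn x = X
  generalize codeEquiv hn y = Y
  obtain ⟨a, ε⟩ := X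
  obtain ⟨b, δ⟩ := Y
  cases ε <;> cases δ <;> simp [addR, permSecond, NearBy, twist]
  · refine exists_congr fun i => and_congr_right fun _ => and_congr_right fun _ => ?_
    exact or_congr Iff.rfl
      ⟨fun h => by linear_combination -h, fun h => by linear_combination -h⟩
  · exact ⟨fun h => by linear_combination (1 - halfRes n) * h + (1 - a) * e2 - ee,
      fun h => by linear_combination (1 - halfRes n) * h - (b - a - halfRes n) * (ee - e2) +
        (halfRes n - 1) * (1 - a) * e2 - (halfRes n - 1) * ee⟩
  · exact fun _ => ⟨fun h => by linear_combination h + (a - 1) * e2 + ee,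
      fun h => by linear_combination h - (a - 1) * e2 - ee⟩
  · refine exists_congr fun i => and_congr_right fun _ => and_congr_right fun _ => ?_
    rw [or_comm]
    exact or_congr ⟨fun h => by linear_combination (1 - halfRes n) * h + i * (ee - e2),
        fun h => by linear_combination (1 - halfRes n) * h - (b - a) * (ee - e2)⟩
      ⟨fun h => by linear_combination (halfRes n - 1) * h + i * (ee - e2),
        fun h => by linear_combination (halfRes n - 1) * h - (b - a) * (ee - e2)⟩

theorem leftCoord_snd (hn : 3 ≤ n) (x : Fin (2 ^ n)) :
    (leftCoord hn x).2 = (codeEquiv hn x).2 := rfl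

theorem rightCoord_snd (hn : 3 ≤ n) (x : Fin (2 ^ n)) :
    (rightCoord hn x).2 = (codeEquiv hn x).2 := rfl

theorem leftModel_adj {u v : ZMod (half n) × Bool} :
    (leftModel n k).Adj u v ↔ (u.2 = v.2 ∧ u.1 ≠ v.1 ∧ NearBy n k u.1 v.1) ∨
      (u.2 ≠ v.2 ∧ (v.1 = twist n u.1 ∨ u.1 = twist n v.1)) :=
  or_congr (and_congr_right fun _ => cyclePower_adj) Iff.rfl

theorem eq_twist_comm (hn : 3 ≤ n) {a b : ZMod (half n)} : a = twist n b ↔ b = twist n a :=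
  ⟨fun h => by rw [h, twist_involutive hn], fun h => by rw [h, twist_involutive hn]⟩

theorem nearBy_comm {a b : ZMod (half n)} : NearBy n k a b ↔ NearBy n k b a :=
  ⟨NearBy.symm, NearBy.symm⟩

/-- The left Cayley graph is isomorphic to the left model. -/
noncomputable def leftIso (hn : 3 ≤ n) (hkm : k < half n) :
    (twoGyrogroup n hn).leftCayleyGraph (genSet n k) ≃g leftModel n k where
  toEquiv := leftCoord hn
  map_rel_iff' := by
    intro x y
    rw [leftModel_adj, Gyrogroup.leftCayleyGraph, SimpleGraph.fromRel_adj,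
      exists_left_iff hn hkm, exists_left_iff hn hkm, ← (leftCoord hn).injective.ne_iff]
    generalize leftCoord hn x = X
    generalize leftCoord hn y = Y
    obtain ⟨a, ε⟩ := X
    obtain ⟨b, δ⟩ := Y
    have h1 := eq_twist_comm hn (a := a) (b := b)
    have h2 := nearBy_comm (k := k) (a := a) (b := b)
    by_cases h : ε = δ
    · simp [h, h2]
    · simp [h, Ne.symm h, h1]

/-- The subgraph of the right Cayley graph is isomorphic to the left model. -/
noncomputable def rightMatchingIso (hn : 3 ≤ n) (hkm : k < half n) :
    rightMatchingGraph n hn k ≃g leftModel n k where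
  toEquiv := rightCoord hn
  map_rel_iff' := by
    intro x y
    -- The parameter `q` decides whether the edges `{x, x ⊕ r}` with `x ∈ T₂`, the identity
    -- matching, are present: `False` gives `R₀`, and `True` gives `R`.
    have key := fun x y => exists_right_iff hn hkm x y False
    simp only [or_false, and_false] at key
    rw [leftModel_adj, rightMatchingGraph, SimpleGraph.fromRel_adj, key, key,
      ← (rightCoord hn).injective.ne_iff]
    generalize rightCoord hn x = X
    generalize rightCoord hn y = Y
    obtain ⟨a, ε⟩ := X
    obtain ⟨b, δ⟩ := Y
    have h1 := eq_twist_comm hn (a := a) (b := b)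
    have h2 := nearBy_comm (k := k) (a := a) (b := b)
    cases ε <;> cases δ <;> simp [h1, h2]

/-- The right Cayley graph is isomorphic to the right model. -/
noncomputable def rightIso (hn : 3 ≤ n) (hkm : k < half n) :
    (twoGyrogroup n hn).rightCayleyGraph (genSet n k) ≃g rightModel n k where
  toEquiv := rightCoord hn
  map_rel_iff' := by
    intro x y
    have key := fun x y => exists_right_iff hn hkm x y True
    simp only [or_true, and_true, implies_true] at key
    rw [SimpleGraph.sup_adj, leftModel_adj, Gyrogroup.rightCayleyGraph, SimpleGraph.fromRel_adj,
      key, key, ← (rightCoord hn).injective.ne_iff]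
    simp only [crossGraph, id]
    generalize rightCoord hn x = X
    generalize rightCoord hn y = Y
    obtain ⟨a, ε⟩ := X
    obtain ⟨b, δ⟩ := Y
    have h1 := eq_twist_comm hn (a := a) (b := b)
    have h2 := nearBy_comm (k := k) (a := a) (b := b)
    cases ε <;> cases δ <;> simp [h1, h2, eq_comm (a := a) (b := b), or_comm]

theorem nonempty_induce_iso {V W : Type*} {G : SimpleGraph V} {M : SimpleGraph (W × Bool)}
    {H : SimpleGraph W} (e : G ≃g M) {ε : Bool}
    (hM : ∀ a b, M.Adj (a, ε) (b, ε) ↔ H.Adj a b) {A : Set V}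
    (hA : ∀ x, x ∈ A ↔ (e x).2 = ε) : Nonempty (G.induce A ≃g H) := by
  have hx : ∀ x : A, e x = ((e x).1, ε) := fun x => Prod.ext rfl ((hA x).1 x.2)
  refine ⟨⟨⟨fun x => (e x).1, fun a => ⟨e.symm (a, ε), by simp [hA]⟩, fun x => ?_,
    fun a => by simp⟩, ?_⟩⟩
  · apply Subtype.ext
    simp only
    rw [← hx, RelIso.symm_apply_apply]
  · intro x y
    simp only [Equiv.coe_fn_mk, SimpleGraph.comap_adj, Function.Embedding.subtype_apply]
    rw [← hM, ← hx, ← hx, e.map_adj_iff]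

theorem leftModel_adj_same {a b : ZMod (half n)} {ε : Bool} :
    (leftModel n k).Adj (a, ε) (b, ε) ↔ (cyclePower (half n) k).Adj a b := by
  rw [leftModel_adj, cyclePower_adj]
  simp [NearBy]

theorem rightModel_adj_same {a b : ZMod (half n)} {ε : Bool} :
    (rightModel n k).Adj (a, ε) (b, ε) ↔ (cyclePower (half n) k).Adj a b := by
  rw [SimpleGraph.sup_adj, leftModel_adj_same]
  simp [crossGraph]

theorem isCompl_T₁_T₂ : IsCompl (T₁ n) (T₂ n) := by
  have h : T₂ n = (T₁ n)ᶜ := by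
    ext x
    simp [T₁, T₂]
  rw [h]
  exact isCompl_compl

theorem isTwoCopies_of_iso (hn : 3 ≤ n) {G : SimpleGraph (Fin (2 ^ n))}
    (e : G ≃g leftModel n k) (he : ∀ x, (e x).2 = (codeEquiv hn x).2) :
    IsTwoCopiesJoinedByMatching G (cyclePower (half n) k) (T₁ n) (T₂ n) := by
  have h1 : ∀ x, x ∈ T₁ n ↔ (e x).2 = false := fun x => by rw [mem_T₁_iff hn, he]
  have h2 : ∀ x, x ∈ T₂ n ↔ (e x).2 = true := fun x => by rw [mem_T₂_iff hn, he]
  have key : ∀ x ε, (e x).2 ≠ ε → ∃! y, (e y).2 = ε ∧ G.Adj x y := by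
    intro x ε hx
    refine ⟨e.symm (twist n (e x).1, ε), ⟨by simp, ?_⟩, ?_⟩
    · rw [← e.map_adj_iff, RelIso.apply_symm_apply, leftModel_adj]
      exact Or.inr ⟨hx, Or.inl rfl⟩
    · rintro y ⟨rfl, hy⟩
      rw [← e.map_adj_iff, leftModel_adj] at hy
      rw [← RelIso.symm_apply_apply e y]
      congr 1
      rcases hy with ⟨h, -⟩ | ⟨-, h | h⟩
      · exact absurd h hx
      · exact Prod.ext h (by simp)
      · exact Prod.ext ((eq_twist_comm hn).1 h) (by simp)
  refine ⟨isCompl_T₁_T₂, nonempty_induce_iso e (fun _ _ => leftModel_adj_same) h1,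
    nonempty_induce_iso e (fun _ _ => leftModel_adj_same) h2, fun a ha => ?_, fun b hb => ?_⟩
  · simpa only [h2] using key a true (by rw [(h1 a).1 ha]; simp)
  · simpa only [h1, G.adj_comm] using key b false (by rw [(h2 b).1 hb]; simp)

theorem rightMatchingGraph_le (hn : 3 ≤ n) :
    rightMatchingGraph n hn k ≤ (twoGyrogroup n hn).rightCayleyGraph (genSet n k) := by
  intro x y h
  refine ⟨h.1, h.2.imp ?_ ?_⟩ <;> exact fun ⟨s, hs, h, _⟩ => ⟨s, hs, h⟩

end Coordinates

theorem mainTheorem9 (n : ℕ) (hn : 3 ≤ n) (k : ℕ) (hk : 1 ≤ k) (hkm : k < 2 ^ (n - 1)) :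
    let H := cyclePower (2 ^ (n - 1)) k
    let L := (twoGyrogroup n hn).leftCayleyGraph (TwoGyrogroup.genSet n k)
    let R := (twoGyrogroup n hn).rightCayleyGraph (TwoGyrogroup.genSet n k)
    let R₀ := TwoGyrogroup.rightMatchingGraph n hn k
    (IsTwoCopiesJoinedByMatching L H (TwoGyrogroup.T₁ n) (TwoGyrogroup.T₂ n) ∧
      SatisfiesTCC L ∧ (IsTypeI H → IsTypeI L)) ∧
    (Nonempty (R.induce (TwoGyrogroup.T₁ n) ≃g H) ∧
      Nonempty (R.induce (TwoGyrogroup.T₂ n) ≃g H) ∧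
      SatisfiesTCC R ∧ (IsTypeI H → IsTypeI R)) ∧
    (R₀ ≤ R ∧ IsTwoCopiesJoinedByMatching R₀ H (TwoGyrogroup.T₁ n) (TwoGyrogroup.T₂ n) ∧
      SatisfiesTCC R₀ ∧ (IsTypeI H → IsTypeI R₀)) :=
  ⟨⟨isTwoCopies_of_iso hn (leftIso hn hkm) (leftCoord_snd hn),
      leftModel_conclusions hn hk (leftIso hn hkm)⟩,
    ⟨nonempty_induce_iso (rightIso hn hkm) (fun _ _ => rightModel_adj_same)
        fun x => by rw [mem_T₁_iff hn, ← rightCoord_snd]; rfl,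
      nonempty_induce_iso (rightIso hn hkm) (fun _ _ => rightModel_adj_same)
        fun x => by rw [mem_T₂_iff hn, ← rightCoord_snd]; rfl,
      rightModel_conclusions hn hk (rightIso hn hkm)⟩,
    rightMatchingGraph_le hn, isTwoCopies_of_iso hn (rightMatchingIso hn hkm) (rightCoord_snd hn),
      leftModel_conclusions hn hk (rightMatchingIso hn hkm)⟩
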